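/- Let $\mathfrak g$ be a finite-dimensional complex simple Lie algebra of simply laced type with Chevalley generators $x_i^\pm,h_i$ $(i\in I)$, let $\mathfrak h$ be the span of the $h_i$ and $\mathfrak n^+$ the subalgebra generated by the $x_i^+$. Let $\sigma\neq\mathrm{id}$ be a diagram automorphism of $\mathfrak g$, i.e. $\sigma(x_i^\pm)=x_{\sigma(i)}^\pm$ for a permutation $\sigma$ of $I$; let $m$ be its order and $\zeta$ a primitive $m$-th root of unity. Put $\mathfrak g_\epsilon=\{x\in\mathfrak g:\sigma(x)=\zeta^\epsilon x\}$ and let $$L^\sigma(\mathfrak g)=\bigoplus_{\epsilon=0}^{m-1}\mathfrak g_\epsilon\otimes t^{m-\epsilon}\mathbb C[t^m,t^{-m}]$$ be the twisted loop algebra, i.e. the fixed points of $x\otimes t^k\mapsto\zeta^k\sigma(x)\otimes t^k$ on $\mathfrak g\otimes\mathbb C[t,t^{-1}]$. Let $L^\sigma(\mathfrak n^+)=L^\sigma(\mathfrak g)\cap(\mathfrak n^+\otimes\mathbb C[t,t^{-1}])$. Let $I_0\subset I$ be a set of representatives of the $\sigma$-orbits. Call $i\in I_0$ a middle node if $i$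 and $\sigma(i)$ are joined in the Dynkin diagram; this occurs only in type $A_{2n}$, for the one node $i=n$ of $I_0$ that gives the short simple root of $\mathfrak g_0$. For $i\in I_0$ and $\epsilon\in\mathbb Z/m$ let $h_{i,0}=h_i$, $h_{i,\epsilon}=0$ $(\epsilon\ne0)$, $x_{i,0}^-=x_i^-$ if $\sigma(i)=i$; let $h_{i,0}=2(h_i+h_{\sigma(i)})$, $h_{i,1}=h_i-h_{\sigma(i)}$, $x_{i,0}^-=\sqrt2(x_i^-+x_{\sigma(i)}^-)$ if $i$ is a middle node; and let $h_{i,\epsilon}=\sum_{j=0}^{m-1}\zeta^{-j\epsilon}h_{\sigma^j(i)}$, $x_{i,0}^-=\sum_{j=0}^{m-1}x^-_{\sigma^j(i)}$ otherwise. The $h_{i,0}$ are the simple coroots of $\mathfrak g_0$ and a basis of $\mathfrak h_0=\mathfrak h\cap\mathfrak g_0$. Define power series in $u$ over $U(L^\sigma(\mathfrak g))$ by $$\mathbf p^\pm_{i,\sigma}(u)=\begin{cases}\exp\Big(-\sum_{k\ge1}\frac{h_{i,0}\otimes t^{\pm mk}}{k}u^k\Big)&\text{if }\sigma(i)=i,\\[1mm]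 \exp\Big(-\sum_{k\ge1}\frac{(h_{i,0}/2)\otimes t^{\pm2k}}{2k}u^{2k}+\sum_{k\ge1}\frac{h_{i,1}\otimes t^{\pm(2k-1)}}{2k-1}u^{2k-1}\Big)&\text{if $i$ is a middle node},\\[1mm] \exp\Big(-\sum_{k\ge1}\frac{h_{i,\mp k}\otimes t^{\pm k}}{k}u^k\Big)&\text{otherwise}\end{cases}$$ (indices $\mp k$ modulo $m$). Let $P_\sigma^+$ be the set of dominant integral weights $\lambda$ of $\mathfrak g_0$ such that $\lambda(h_{i,0})$ is even if $i$ is a middle node. For $\lambda\in P_\sigma^+$ and $a\in\mathbb C^\times$ let $\pi^\sigma_{\lambda,a}$ be the $I_0$-tuple of polynomials in $u$ whose $i$-th entry is $(1-a^mu)^{\lambda(h_{i,0})}$ if $\sigma(i)=i$, $(1-au)^{\lambda(h_{i,0})/2}$ if $i$ is a middle node, and $(1-au)^{\lambda(h_{i,0})}$ otherwise. Let $\mathcal P_\sigma^+$ be the monoid (under componentwise multiplication) generated by the $\pi^\sigma_{\lambda,a}$. For $\pi^\sigma=(\pi_i)_{i\in I_0}\in\mathcal P_\sigma^+$ let $\lambda_\pi$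 be the weight of $\mathfrak g_0$ with $\lambda_\pi(h_{i,0})=\deg\pi_i$, and $\lambda_\pi(h_{i,0})=2\deg\pi_i$ if $i$ is a middle node; put $\pi_i^+=\pi_i$, and $\pi_i^-=\prod_c(1-c^{-1}u)$ if $\pi_i=\prod_c(1-cu)$. The Weyl module $W(\pi^\sigma)$ is the $U(L^\sigma(\mathfrak g))$-module generated by an element $w$ with the defining relations $$L^\sigma(\mathfrak n^+)w=0,\quad hw=\lambda_\pi(h)w,\quad (x_{i,0}^-\otimes 1)^{\lambda_\pi(h_{i,0})+1}w=0,\quad \big(\mathbf p^\pm_{i,\sigma}(u)-\pi_i^\pm(u)\big)w=0\qquad(h\in\mathfrak h_0,\ i\in I_0).$$ **Proposition.** For every $\pi^\sigma\in\mathcal P_\sigma^+$ there is an integer $N=N(\pi^\sigma)\ge0$ such that, whenever $\pi^\sigma=\prod_{r=1}^{\ell}\pi^\sigma_{\lambda_r,a_r}$ with $\lambda_r\in P_\sigma^+$ and $a_r\in\mathbb C^\times$, $$\Big(\bigoplus_{\epsilon=0}^{m-1}\mathfrak g_\epsilon\otimes t^{m-\epsilon}\prod_{r=1}^{\ell}(t^m-a_r^m)^N\,\mathbb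 C[t^m,t^{-m}]\Big)W(\pi^\sigma)=0 .$$ -/

import Mathlib

open scoped TensorProduct LaurentPolynomial

namespace TwistedLoop

noncomputable section

variable {g I : Type*} [LieRing g] [LieAlgebra ℂ g] [Fintype I]
  {H : LieSubalgebra ℂ g}

/-- A diagram automorphism of `g` with respect to Chevalley generators
`x_i^+ = b.e i`, `x_i^- = b.f i`, `h_i = b.h i`: a Lie algebra automorphism which permutes the
Chevalley generators through a permutation of the nodes of the Dynkin diagram. -/
structure DiagramAut (b : LieAlgebra.Basis I H) where
  toLieEquiv : g ≃ₗ⁅ℂ⁆ g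
  perm : Equiv.Perm I
  map_e : ∀ i, toLieEquiv (b.e i) = b.e (perm i)
  map_f : ∀ i, toLieEquiv (b.f i) = b.f (perm i)

variable {b : LieAlgebra.Basis I H}

namespace DiagramAut

lemma map_h (σ : DiagramAut b) (i : I) : σ.toLieEquiv (b.h i) = b.h (σ.perm i) := by
  rw [← (b.sl2 i).lie_e_f, ← (b.sl2 (σ.perm i)).lie_e_f, LieEquiv.map_lie, σ.map_e, σ.map_f]

/-- The order `m` of `σ`. As the Chevalley generators generate `g` and are distinct, the order of
`σ` as an automorphism of `g` is the order of the permutation of the nodes. -/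
def order (σ : DiagramAut b) : ℕ := orderOf σ.perm

/-- The node `i` is joined to its image by an edge. In the simply laced case this happens exactly
when `g` is of type `A_{2n}`, `σ` is the flip, and `i` is one of the two middle nodes (the ones
labelled `n` and `n + 1`, which form the orbit that is the short simple root of `g_0`). -/
def IsMiddle (σ : DiagramAut b) (i : I) : Prop := b.A i (σ.perm i) = -1

instance (σ : DiagramAut b) : DecidablePred σ.IsMiddle := fun i =>
  inferInstanceAs (Decidable (b.A i (σ.perm i) = -1))

/-- `I₀`, as a subset of `I`: a set of representatives of the orbits of `σ` on the nodes. -/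
def IsOrbitReps (σ : DiagramAut b) (I₀ : Finset I) : Prop :=
  ∀ i, ∃! j, j ∈ I₀ ∧ σ.perm.SameCycle j i

variable (σ : DiagramAut b) (ζ : ℂ)

/-- The eigenspace `g_ε = {x : σ x = ζ^ε x}`. -/
def eigen (ε : ℤ) : Submodule ℂ g where
  carrier := {x | σ.toLieEquiv x = ζ ^ ε • x}
  add_mem' {x y} hx hy := by
    simp only [Set.mem_ofPred_eq] at hx hy ⊢
    rw [map_add, hx, hy, smul_add]
  zero_mem' := by simp
  smul_mem' c x hx := by
    simp only [Set.mem_ofPred_eq] at hx ⊢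
    rw [map_smul, hx, smul_comm]

lemma mem_eigen {ε : ℤ} {x : g} : x ∈ σ.eigen ζ ε ↔ σ.toLieEquiv x = ζ ^ ε • x := Iff.rfl

/-- The sum `∑_{0 ≤ j < m} ζ^{-jε} y_{σ^j(i)}`. -/
def orbitSum (y : I → g) (i : I) (ε : ℤ) : g :=
  ∑ j ∈ Finset.range σ.order, ζ ^ (-(j * ε)) • y ((σ.perm ^ j) i)

lemma orbitSum_mem {ζ : ℂ} (hζ : IsPrimitiveRoot ζ σ.order) (hm : 0 < σ.order) (y : I → g)
    (hy : ∀ i, σ.toLieEquiv (y i) = y (σ.perm i)) (i : I) (ε : ℤ) :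
    σ.orbitSum ζ y i ε ∈ σ.eigen ζ ε := by
  have hζ0 : ζ ≠ 0 := hζ.ne_zero hm.ne'
  rw [mem_eigen, orbitSum, map_sum, Finset.smul_sum]
  let F : ℕ → g := fun j => ζ ^ (ε - j * ε) • y ((σ.perm ^ j) i)
  have h1 : ∀ j : ℕ, σ.toLieEquiv (ζ ^ (-(j * ε)) • y ((σ.perm ^ j) i)) = F (j + 1) := by
    intro j
    simp only [F]
    rw [map_smul, hy, pow_succ', Equiv.Perm.mul_apply]
    congr 2
    push_cast
    ring
  have h2 : ∀ j : ℕ, ζ ^ ε • ζ ^ (-(j * ε)) • y ((σ.perm ^ j) i) = F j := by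
    intro j
    simp only [F]
    rw [smul_smul, ← zpow_add₀ hζ0]
    congr 2
  rw [Finset.sum_congr rfl (fun j _ => h1 j), Finset.sum_congr rfl (fun j _ => h2 j)]
  have h3 : F σ.order = F 0 := by
    have hp : σ.perm ^ σ.order = 1 := pow_orderOf_eq_one _
    have hz : ζ ^ (ε - (σ.order : ℤ) * ε) = ζ ^ ε := by
      rw [zpow_sub₀ hζ0, zpow_mul, zpow_natCast, hζ.pow_eq_one, one_zpow, div_one]
    simp only [F]
    rw [hp, hz]
    simp
  have h4 := Finset.sum_range_succ F σ.order
  rw [Finset.sum_range_succ', h3] at h4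
  exact add_right_cancel h4

lemma order_pos : 0 < σ.order := orderOf_pos _

section Generators

variable [DecidableEq I]

/-- The elements `h_{i,ε} ∈ g_ε`, for `ε` modulo `m`:
* if `σ(i) = i`, then `h_{i,0} = h_i` and `h_{i,ε} = 0` otherwise;
* if `i` is the middle node in type `A_{2n}`, then `h_{i,0} = 2 (h_i + h_{σ(i)})` and
  `h_{i,1} = h_i - h_{σ(i)}`;
* otherwise `h_{i,ε} = ∑_j ζ^{-jε} h_{σ^j(i)}`.

The `h_{i,0}`, `i ∈ I₀`, are the simple coroots of `g_0` and a basis of `h_0`. -/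
def hEps (i : I) (ε : ℤ) : g :=
  if σ.perm i = i then (if (σ.order : ℤ) ∣ ε then b.h i else 0)
  else if σ.IsMiddle i then
    (if (σ.order : ℤ) ∣ ε then (2 : ℂ) else 1) • σ.orbitSum ζ b.h i ε
  else σ.orbitSum ζ b.h i ε

/-- The Chevalley generator `x_{i,0}^-` of `g_0`: it is `x_i^-` if `σ(i) = i`, it is
`√2 (x_i^- + x_{σ(i)}^-)` for the middle node in type `A_{2n}`, and the sum over the orbit
otherwise. -/
def xMinus (i : I) : g :=
  if σ.perm i = i then b.f i
  else if σ.IsMiddle i then (Real.sqrt 2 : ℂ) • σ.orbitSum ζ b.f i 0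
  else σ.orbitSum ζ b.f i 0

lemma hEps_mem {ζ : ℂ} (hζ : IsPrimitiveRoot ζ σ.order) (i : I) (ε : ℤ) :
    σ.hEps ζ i ε ∈ σ.eigen ζ ε := by
  unfold hEps
  split_ifs with h1 h2 h3
  · obtain ⟨c, rfl⟩ := h2
    rw [mem_eigen, σ.map_h, h1, zpow_mul, zpow_natCast, hζ.pow_eq_one, one_zpow, one_smul]
  · exact zero_mem _
  · exact Submodule.smul_mem _ _ (σ.orbitSum_mem hζ σ.order_pos _ σ.map_h _ _)
  · exact Submodule.smul_mem _ _ (σ.orbitSum_mem hζ σ.order_pos _ σ.map_h _ _)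
  · exact σ.orbitSum_mem hζ σ.order_pos _ σ.map_h _ _

lemma xMinus_mem {ζ : ℂ} (hζ : IsPrimitiveRoot ζ σ.order) (i : I) :
    σ.xMinus ζ i ∈ σ.eigen ζ 0 := by
  unfold xMinus
  split_ifs with h1 h2
  · rw [mem_eigen, σ.map_f, h1, zpow_zero, one_smul]
  · exact Submodule.smul_mem _ _ (σ.orbitSum_mem hζ σ.order_pos _ σ.map_f _ _)
  · exact σ.orbitSum_mem hζ σ.order_pos _ σ.map_f _ _

end Generators

/-! ### The twisted loop algebra -/

/-- The automorphism `t^k ↦ ζ^k t^k` of `ℂ[t, t⁻¹]`. -/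
def scale {ζ : ℂ} (hζ : ζ ≠ 0) : ℂ[T;T⁻¹] →ₐ[ℂ] ℂ[T;T⁻¹] :=
  AddMonoidAlgebra.lift ℂ ℂ[T;T⁻¹] ℤ
    { toFun := fun k => ζ ^ k.toAdd • LaurentPolynomial.T k.toAdd
      map_one' := by simp
      map_mul' := fun k l => by
        rw [toAdd_mul, zpow_add₀ hζ, LaurentPolynomial.T_add, smul_mul_smul_comm] }

lemma scale_T {ζ : ℂ} (hζ : ζ ≠ 0) (k : ℤ) :
    scale hζ (LaurentPolynomial.T k) = ζ ^ k • LaurentPolynomial.T k := by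
  rw [scale, LaurentPolynomial.T, AddMonoidAlgebra.lift_single, one_smul]
  rfl

variable {ζ} (hζ : IsPrimitiveRoot ζ σ.order)

/-- The map `σ̃ (x ⊗ t^k) = ζ^k σ(x) ⊗ t^k` on the loop algebra. -/
def twist : LieAlgebra.loopAlgebra ℂ ℤ g →ₗ⁅ℂ⁆ LieAlgebra.loopAlgebra ℂ ℤ g :=
  LieAlgebra.ExtendScalars.map (scale (hζ.ne_zero σ.order_pos.ne')) σ.toLieEquiv.toLieHom

lemma twist_tmul (f : ℂ[T;T⁻¹]) (x : g) :
    σ.twist hζ (f ⊗ₜ[ℂ] x) =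
      (scale (hζ.ne_zero σ.order_pos.ne') f) ⊗ₜ[ℂ] σ.toLieEquiv x := rfl

/-- The twisted loop algebra `L^σ(g)`: the fixed points of `σ̃`. -/
def twistedLoop : LieSubalgebra ℂ (LieAlgebra.loopAlgebra ℂ ℤ g) where
  carrier := {x | σ.twist hζ x = x}
  add_mem' {x y} hx hy := by
    simp only [Set.mem_ofPred_eq] at hx hy ⊢
    rw [map_add, hx, hy]
  zero_mem' := by simp
  smul_mem' c x hx := by
    simp only [Set.mem_ofPred_eq] at hx ⊢
    rw [map_smul, hx]
  lie_mem' {x y} hx hy := by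
    simp only [Set.mem_ofPred_eq] at hx hy
    change σ.twist hζ ⁅x, y⁆ = ⁅x, y⁆
    rw [LieHom.map_lie, hx, hy]

lemma mem_twistedLoop {x : LieAlgebra.loopAlgebra ℂ ℤ g} :
    x ∈ σ.twistedLoop hζ ↔ σ.twist hζ x = x := Iff.rfl

lemma T_tmul_mem (k : ℤ) {x : g} (hx : x ∈ σ.eigen ζ (-k)) :
    (LaurentPolynomial.T k : ℂ[T;T⁻¹]) ⊗ₜ[ℂ] x ∈ σ.twistedLoop hζ := by
  have h0 : ζ ≠ 0 := hζ.ne_zero σ.order_pos.ne'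
  rw [mem_twistedLoop, twist_tmul, scale_T, (σ.mem_eigen ζ).1 hx, TensorProduct.smul_tmul_smul,
    zpow_neg, mul_inv_cancel₀ (zpow_ne_zero _ h0), one_smul]

/-- The space `⨁_{0 ≤ ε < m} g_ε ⊗ t^{m-ε} ∏_r (t^m - a_r^m)^N ℂ[t^m, t^{-m}]`. -/
def annSpace (ζ : ℂ) {l : ℕ} (a : Fin l → ℂˣ) (N : ℕ) :
    Submodule ℂ (LieAlgebra.loopAlgebra ℂ ℤ g) :=
  ⨆ ε : Fin σ.order, Submodule.span ℂ
    {z | ∃ x ∈ σ.eigen ζ ((ε : ℕ) : ℤ),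
      ∃ f ∈ Algebra.adjoin ℂ
        {(LaurentPolynomial.T (σ.order : ℤ) : ℂ[T;T⁻¹]), LaurentPolynomial.T (-(σ.order : ℤ))},
      z = (LaurentPolynomial.T ((σ.order : ℤ) - (ε : ℕ)) *
        (∏ r, (LaurentPolynomial.T (σ.order : ℤ) -
          LaurentPolynomial.C ((a r : ℂ) ^ σ.order)) ^ N) * f) ⊗ₜ[ℂ] x}

lemma annSpace_le {l : ℕ} (a : Fin l → ℂˣ) (N : ℕ) :
    σ.annSpace ζ a N ≤ (σ.twistedLoop hζ).toSubmodule := by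
  have h0 : ζ ≠ 0 := hζ.ne_zero σ.order_pos.ne'
  refine iSup_le fun ε => Submodule.span_le.2 ?_
  rintro z ⟨x, hx, f, hf, rfl⟩
  have hT : scale h0 (LaurentPolynomial.T (σ.order : ℤ)) = LaurentPolynomial.T (σ.order : ℤ) := by
    rw [scale_T, zpow_natCast, hζ.pow_eq_one, one_smul]
  have hf' : scale h0 f = f := by
    have : Algebra.adjoin ℂ {(LaurentPolynomial.T (σ.order : ℤ) : ℂ[T;T⁻¹]),
        LaurentPolynomial.T (-(σ.order : ℤ))} ≤ AlgHom.equalizer (scale h0) (AlgHom.id ℂ _) := by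
      refine Algebra.adjoin_le ?_
      rintro p (rfl | rfl)
      · exact hT
      · change scale h0 _ = _
        rw [scale_T, zpow_neg, zpow_natCast, hζ.pow_eq_one, inv_one, one_smul]
        rfl
    exact this hf
  have hC : ∀ c : ℂ, scale h0 (LaurentPolynomial.C c) = LaurentPolynomial.C c := fun c =>
    (scale h0).commutes c
  change σ.twist hζ _ = _
  rw [twist_tmul, (σ.mem_eigen ζ).1 hx, map_mul, map_mul, hf', map_prod, scale_T]
  simp only [map_pow, map_sub, hT, hC]
  rw [zpow_sub₀ h0, zpow_natCast, hζ.pow_eq_one, smul_mul_assoc, smul_mul_assoc,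
    TensorProduct.smul_tmul_smul, one_div, zpow_natCast, inv_mul_cancel₀ (pow_ne_zero _ h0),
    one_smul]

variable [DecidableEq I]

/-- The element `h_{i,ε} ⊗ t^k` of `L^σ(g)`, where `ε ≡ -k` modulo `m`. -/
def hLoop (i : I) (k : ℤ) : σ.twistedLoop hζ :=
  ⟨(LaurentPolynomial.T k : ℂ[T;T⁻¹]) ⊗ₜ[ℂ] σ.hEps ζ i (-k), σ.T_tmul_mem hζ k (σ.hEps_mem hζ i _)⟩

/-- The element `x_{i,0}^- ⊗ 1` of `L^σ(g)`. -/
def xLoop (i : I) : σ.twistedLoop hζ :=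
  ⟨(LaurentPolynomial.T 0 : ℂ[T;T⁻¹]) ⊗ₜ[ℂ] σ.xMinus ζ i,
    σ.T_tmul_mem hζ 0 (by simpa using σ.xMinus_mem hζ i)⟩

/-- The subalgebra `n^+` of `g`, generated by the `x_i^+`. -/
def nPlus (b : LieAlgebra.Basis I H) : LieSubalgebra ℂ g :=
  LieSubalgebra.lieSpan ℂ g (Set.range b.e)

/-! ### The power series `P_{i,σ}^±(u)` -/

/-- The enveloping algebra `U(L^σ(g))`. -/
abbrev Env : Type _ := UniversalEnvelopingAlgebra ℂ (σ.twistedLoop hζ)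

/-- The power series in `u` of which `P_{i,σ}^±(u)` is the exponential (the sign is `s = ±1`):
* `- ∑_{k ≥ 1} (h_{i,0} ⊗ t^{±mk}) / k * u^k` if `σ(i) = i`;
* `- ∑_{k ≥ 1} ((h_{i,0} / 2) ⊗ t^{±2k}) / (2k) * u^{2k}
    + ∑_{k ≥ 1} (h_{i,1} ⊗ t^{±(2k-1)}) / (2k-1) * u^{2k-1}` for the middle node in type `A_{2n}`;
* `- ∑_{k ≥ 1} (h_{i,ε} ⊗ t^{±k}) / k * u^k` with `ε ≡ ∓k` modulo `m` otherwise. -/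
def logP (s : ℤˣ) (i : I) : PowerSeries (σ.Env hζ) :=
  PowerSeries.mk fun k =>
    if k = 0 then 0
    else if σ.perm i = i then
      (-(1 / (k : ℂ))) • UniversalEnvelopingAlgebra.ι ℂ (σ.hLoop hζ i (s * (σ.order * k)))
    else if σ.IsMiddle i then
      (if Even k then (-(1 / (2 * (k : ℂ)))) else 1 / (k : ℂ)) •
        UniversalEnvelopingAlgebra.ι ℂ (σ.hLoop hζ i (s * k))
    else (-(1 / (k : ℂ))) • UniversalEnvelopingAlgebra.ι ℂ (σ.hLoop hζ i (s * k))

/-- The exponential of a power series without constant term: as `F ^ j` starts in degree `j`,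
only the terms `F ^ j / j!` with `j ≤ n` contribute to the coefficient of `u ^ n`. -/
def psExp {A : Type*} [Ring A] [Algebra ℂ A] (F : PowerSeries A) : PowerSeries A :=
  PowerSeries.mk fun n =>
    ∑ j ∈ Finset.range (n + 1), (1 / (j.factorial : ℂ)) • PowerSeries.coeff n (F ^ j)

/-- The power series `P_{i,σ}^±(u)`. -/
def P (s : ℤˣ) (i : I) : PowerSeries (σ.Env hζ) := psExp (σ.logP hζ s i)

/-! ### The monoid `𝒫_σ^+` -/

variable (I₀ : Finset I)

/-- `P_σ^+`: the dominant integral weights `λ = ∑_{i ∈ I₀} λ(h_{i,0}) ω_i` of `g_0`, given by the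
numbers `λ i = λ(h_{i,0})`, with `λ(h_{n,0})` even in type `A_{2n}`. -/
def weights : Set (I₀ → ℕ) := {lam | ∀ i : I₀, σ.IsMiddle i → Even (lam i)}

/-- The tuple `π_{i,a}^σ`: its `i`-th entry is `1 - a^m u` if `σ(i) = i` (that is, if `g` is not of
type `A_{2n}` and `α_i` is a long root of `g_0`) and `1 - a u` otherwise; the other entries
are `1`. -/
def piGen (i : I₀) (a : ℂˣ) : I₀ → Polynomial ℂ :=
  Pi.mulSingle i (1 - Polynomial.C
    (if σ.perm i = i then (a : ℂ) ^ σ.order else (a : ℂ)) * Polynomial.X)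

/-- `π_{λ,a}^σ = ∏_i (π_{i,a}^σ)^{λ(h_{i,0})}`, with exponent `λ(h_{n,0}) / 2` for the middle node
in type `A_{2n}`. -/
def piWeight (lam : I₀ → ℕ) (a : ℂˣ) : I₀ → Polynomial ℂ :=
  ∏ i : I₀, σ.piGen I₀ i a ^ (if σ.IsMiddle i then lam i / 2 else lam i)

/-- The monoid `𝒫_σ^+` generated by the `π_{λ,a}^σ`. -/
def monoidP : Submonoid (I₀ → Polynomial ℂ) :=
  Submonoid.closure {p | ∃ lam ∈ σ.weights I₀, ∃ a : ℂˣ, p = σ.piWeight I₀ lam a}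

variable {I₀}

/-- The weight `λ_π`: `λ_π(h_{i,0}) = deg π_i`, and `2 deg π_n` for the middle node in
type `A_{2n}`. -/
def wt (p : I₀ → Polynomial ℂ) (i : I₀) : ℕ :=
  if σ.IsMiddle i then 2 * (p i).natDegree else (p i).natDegree

/-- The polynomials `π^±`: if `π = ∏ (1 - c u)`, then `π^+ = π` and `π^- = ∏ (1 - c⁻¹ u)`. -/
def signPoly (s : ℤˣ) (p : Polynomial ℂ) : Polynomial ℂ :=
  if s = 1 then p else Polynomial.C p.leadingCoeff⁻¹ * p.reverse

/-! ### The Weyl module -/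

/-- The defining relations of the Weyl module `W(π^σ)`: the elements of `U(L^σ(g))` that kill the
generator. -/
inductive Rel (p : I₀ → Polynomial ℂ) : σ.Env hζ → Prop
  /-- `L^σ(n^+) w = 0` -/
  | nPlus (x : σ.twistedLoop hζ)
      (hx : (x : LieAlgebra.loopAlgebra ℂ ℤ g) ∈
        Submodule.baseChange ℂ[T;T⁻¹] (nPlus b).toSubmodule) :
      Rel p (UniversalEnvelopingAlgebra.ι ℂ x)
  /-- `h w = λ_π(h) w` for `h` in the basis `h_{i,0}`, `i ∈ I₀`, of `h_0` -/
  | weight (i : I₀) :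
      Rel p (UniversalEnvelopingAlgebra.ι ℂ (σ.hLoop hζ i 0) -
        algebraMap ℂ _ (σ.wt p i : ℂ))
  /-- `(x_{i,0}^-)^{λ_π(h_{i,0}) + 1} w = 0` -/
  | integrable (i : I₀) :
      Rel p (UniversalEnvelopingAlgebra.ι ℂ (σ.xLoop hζ i) ^ (σ.wt p i + 1))
  /-- `(P_{i,σ}^±(u) - π_i^±(u)) w = 0`, coefficient by coefficient -/
  | series (s : ℤˣ) (i : I₀) (n : ℕ) :
      Rel p (PowerSeries.coeff n (σ.P hζ s i) -
        algebraMap ℂ _ ((signPoly s (p i)).coeff n))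

/-- The Weyl module `W(π^σ)`: the quotient of `U(L^σ(g))` by the left ideal generated by the
defining relations. An element `x` of `L^σ(g)` acts through its image in `U(L^σ(g))`. -/
abbrev WeylModule (p : I₀ → Polynomial ℂ) : Type _ :=
  σ.Env hζ ⧸ Submodule.span (σ.Env hζ) {u | σ.Rel hζ p u}

end DiagramAut

end

end TwistedLoop

/-! Let w be the generator. By Newton's identities the relations on the series `P` say that the h_i
⊗ t^k act on w through the power sums of the inverse roots of π_i. Averaged over σ, h_i ⊗ r(t^m)
therefore acts as a constant times a sum of values of r: at the inverse roots c if σ(i) = i, at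
their powers c^m otherwise. Let Q (`rootPoly`) have simple roots at all these points, so that every
h_i ⊗ Q(t^m)r(t^m) kills w.

A Garland-type computation with X = e_i ⊗ Q, Y_j = f_i ⊗ Q^j, H_j = h_i ⊗ Q^j turns (f_i ⊗ 1)^{n+1}
w = 0 into (f_i ⊗ Q^n) w = 0 (`smul_eq_zero_of_pow_smul_eq_zero`). Bracketing with h_i ⊗ t^k gives
the same for every power of t (`f_mem_annSub`). The scalars that have to be nonzero are twisted row
sums of the Cartan matrix, controlled by its positive definiteness (`sum_A_mul_pow_ne_zero`).

Twisting is handled by summing σ̃^l over a period (`tr`, `elt`): brackets and divisibility are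
computed in the untwisted loop algebra. The x in g killed on w by a power of Q form a subalgebra
(`annSub`) containing the Chevalley generators, hence all of g, and finite dimension makes the power
uniform. The averages of Q^N L(g) form an ideal, so they kill all of U·w (`act_tr_smul_eq_zero`).

N does not depend on the factorization of π, because Q is built from π alone and divides ∏(X -
a_r^m) for every factorization (`rootPoly_dvd`). -/

namespace TwistedLoop

open scoped Matrix

noncomputable section

open Finset.HasAntidiagonal (antidiagonal mem_antidiagonal)

/-! ### Exponentials of power series with commuting coefficients. -/

section PowerSeries

variable {A : Type*} [Ring A]

/-- The derivation rule `u (F^{k+1})' = (k+1) (u F') F^k` for a series with commuting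
coefficients, coefficient by coefficient. -/
lemma natCast_mul_coeff_pow_succ (F : PowerSeries A)
    (hF : ∀ i j, Commute (PowerSeries.coeff i F) (PowerSeries.coeff j F)) (k n : ℕ) :
    (n : A) * PowerSeries.coeff n (F ^ (k + 1)) =
      (k + 1 : ℕ) * ∑ p ∈ antidiagonal n,
        (p.1 : A) * PowerSeries.coeff p.1 F * PowerSeries.coeff p.2 (F ^ k) := by
  let D : PowerSeries A := PowerSeries.mk fun j => (j : A) * PowerSeries.coeff j F
  let E : PowerSeries A → PowerSeries A := fun G =>
    PowerSeries.mk fun j => (j : A) * PowerSeries.coeff j G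
  have hE : ∀ G H, E (G * H) = E G * H + G * E H := by
    intro G H
    ext n
    simp only [E, PowerSeries.coeff_mk, PowerSeries.coeff_mul, map_add, Finset.mul_sum,
      ← Finset.sum_add_distrib]
    refine Finset.sum_congr rfl fun p hp => ?_
    rw [← mem_antidiagonal.1 hp, Nat.cast_add, add_mul, mul_assoc, ← mul_assoc _ (p.2 : A),
      ← (Nat.cast_commute p.2 _).eq, mul_assoc]
  have hc : Commute F (E F) := by
    ext n
    rw [PowerSeries.coeff_mul, PowerSeries.coeff_mul, ← Finset.Nat.sum_antidiagonal_swap]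
    refine Finset.sum_congr rfl fun p hp => ?_
    simp only [E, PowerSeries.coeff_mk, Prod.fst_swap, Prod.snd_swap]
    rw [mul_assoc, ← (hF _ _).eq, ← mul_assoc, ← mul_assoc, (Nat.cast_commute p.1 _).eq]
  have key : ∀ k : ℕ, E (F ^ (k + 1)) = (k + 1 : ℕ) * (E F * F ^ k) := by
    intro k
    induction k with
    | zero => simp
    | succ k ih =>
      rw [pow_succ', hE, ih, ← mul_assoc F, ← (Nat.cast_commute (k + 1) F).eq, mul_assoc,
        ← mul_assoc F, hc.eq, mul_assoc, ← pow_succ', Nat.cast_succ (k + 1), add_mul, one_mul,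
        add_comm]
  have := congrArg (PowerSeries.coeff n) (key k)
  rw [← nsmul_eq_mul, map_nsmul, nsmul_eq_mul, PowerSeries.coeff_mul] at this
  simpa only [E, PowerSeries.coeff_mk] using this

variable [Algebra ℂ A]

open DiagramAut in
/-- The differential equation `u (exp F)' = (u F') exp F`. -/
lemma natCast_mul_coeff_psExp (F : PowerSeries A) (h0 : PowerSeries.constantCoeff F = 0)
    (hF : ∀ i j, Commute (PowerSeries.coeff i F) (PowerSeries.coeff j F)) (n : ℕ) :
    (n : A) * PowerSeries.coeff n (psExp F) =
      ∑ p ∈ antidiagonal n,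
        (p.1 : A) * PowerSeries.coeff p.1 F * PowerSeries.coeff p.2 (psExp F) := by
  have hvan : ∀ j n : ℕ, n < j → PowerSeries.coeff n (F ^ j) = 0 := by
    intro j n hn
    obtain ⟨G, rfl⟩ := PowerSeries.X_dvd_iff.2 h0
    have hX : ∀ k : ℕ, (PowerSeries.X * G) ^ k = PowerSeries.X ^ k * G ^ k := fun k =>
      (PowerSeries.commute_X G).symm.mul_pow k
    rw [hX, PowerSeries.coeff_X_pow_mul', if_neg (by omega)]
  -- The truncation in `psExp` may be moved to any larger bound, so that all coefficients can be
  -- written with one common range of summation.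
  have hext : ∀ l N : ℕ, l ≤ N → PowerSeries.coeff l (psExp F) =
      ∑ j ∈ Finset.range (N + 1), (1 / (j.factorial : ℂ)) • PowerSeries.coeff l (F ^ j) := by
    intro l N hl
    rw [psExp, PowerSeries.coeff_mk]
    refine Finset.sum_subset (Finset.range_mono (by omega)) fun j _ hj => ?_
    rw [hvan _ _ (by simpa using hj), smul_zero]
  rcases n with _ | n
  · simp
  rw [hext (n + 1) (n + 1) le_rfl, Finset.sum_range_succ']
  simp only [pow_zero, PowerSeries.coeff_one, Nat.succ_ne_zero, if_false, smul_zero, add_zero]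
  rw [Finset.mul_sum]
  have h1 : ∀ p ∈ antidiagonal (n + 1),
      (p.1 : A) * PowerSeries.coeff p.1 F * PowerSeries.coeff p.2 (psExp F) =
      ∑ j ∈ Finset.range (n + 1), (1 / (j.factorial : ℂ)) •
        ((p.1 : A) * PowerSeries.coeff p.1 F * PowerSeries.coeff p.2 (F ^ j)) := by
    intro p hp
    -- The factor p.1 disposes of p.2 = n + 1; otherwise p.2 ≤ n, and truncation at n matches the
    -- left side, whose index j has been shifted by one.
    rcases Nat.eq_zero_or_pos p.1 with h | h
    · simp [h]
    · have := mem_antidiagonal.1 hp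
      rw [hext p.2 n (by omega), Finset.mul_sum]
      simp only [mul_smul_comm]
  rw [Finset.sum_congr rfl h1, Finset.sum_comm]
  refine Finset.sum_congr rfl fun j _ => ?_
  rw [← Finset.smul_sum, mul_smul_comm, natCast_mul_coeff_pow_succ F hF, ← nsmul_eq_mul,
    ← Nat.cast_smul_eq_nsmul ℂ, smul_smul]
  congr 1
  rw [Nat.factorial_succ]
  have : (j.factorial : ℂ) ≠ 0 := by exact_mod_cast j.factorial_ne_zero
  have : ((j + 1 : ℕ) : ℂ) ≠ 0 := by exact_mod_cast j.succ_ne_zero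
  push_cast at *
  field_simp

end PowerSeries

/-! ### Newton's identities -/

open Polynomial in
/-- The polynomial `∏_c (1 - c u)`. -/
def ofInvRoots (M : Multiset ℂˣ) : ℂ[X] := (M.map fun c : ℂˣ => 1 - C (c : ℂ) * X).prod

/-- The power sums `∑_c c^k`. -/
def powerSum (M : Multiset ℂˣ) (k : ℤ) : ℂ := (M.map fun c : ℂˣ => ((c ^ k : ℂˣ) : ℂ)).sum

open Polynomial in
-- Newton's identities, from the logarithmic derivative of ∏(1 - cu). The case p.1 = 0 is cut out
-- because the power sum of exponent 0 is the number of roots and does not occur in that derivative.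
lemma natCast_mul_coeff_ofInvRoots (M : Multiset ℂˣ) (n : ℕ) :
    (n : ℂ) * (ofInvRoots M).coeff n =
      - ∑ p ∈ antidiagonal n,
        (if p.1 = 0 then 0 else powerSum M p.1) * (ofInvRoots M).coeff p.2 := by
  let S : Multiset ℂˣ → PowerSeries ℂ := fun M =>
    PowerSeries.mk fun k => if k = 0 then 0 else powerSum M k
  have key : PowerSeries.X * PowerSeries.derivative ℂ (ofInvRoots M : PowerSeries ℂ) =
      - (S M * (ofInvRoots M : PowerSeries ℂ)) := by
    induction M using Multiset.induction_on with
    | empty =>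
      have : S 0 = 0 := by ext k; simp [S, powerSum]
      simp [ofInvRoots, this]
    | cons c M ih =>
      have h1 : ofInvRoots (c ::ₘ M) = (1 - C (c : ℂ) * X) * ofInvRoots M := by
        simp [ofInvRoots]
      have h2 : S (c ::ₘ M) = S {c} + S M := by
        ext k; simp only [S, PowerSeries.coeff_mk, map_add]; split_ifs <;> simp [powerSum]
      -- For a single root, S is the geometric series cu/(1 - cu).
      have h3 : S {c} * (1 - PowerSeries.C (c : ℂ) * PowerSeries.X) =
          PowerSeries.C (c : ℂ) * PowerSeries.X := by
        ext k
        rw [mul_sub, mul_one, map_sub, ← mul_assoc, mul_comm _ (PowerSeries.C _), mul_assoc,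
          PowerSeries.coeff_C_mul, PowerSeries.coeff_C_mul]
        rcases k with _ | k
        · simp [S]
        · rw [PowerSeries.coeff_succ_mul_X]
          rcases k with _ | k
          · simp [S, powerSum]
          · simp [S, powerSum, PowerSeries.coeff_X, pow_succ']
      rw [h1, h2]
      simp only [Polynomial.coe_mul, Polynomial.coe_sub, Polynomial.coe_one, Polynomial.coe_C,
        Polynomial.coe_X, Derivation.leibniz, map_sub, smul_eq_mul]
      have h4 : PowerSeries.derivative ℂ (PowerSeries.C (c : ℂ)) = 0 :=
        PowerSeries.derivative_C
      have h5 : PowerSeries.derivative ℂ (1 : PowerSeries ℂ) = 0 :=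
        PowerSeries.derivative_one
      have h6 : PowerSeries.derivative ℂ (PowerSeries.X : PowerSeries ℂ) = 1 :=
        PowerSeries.derivative_X
      rw [h4, h5, h6]
      linear_combination (1 - PowerSeries.C (c : ℂ) * PowerSeries.X) * ih +
        (ofInvRoots M : PowerSeries ℂ) * h3
  have := congrArg (PowerSeries.coeff n) key
  rw [map_neg, PowerSeries.coeff_mul (n := n) (φ := S M)] at this
  simp only [S, PowerSeries.coeff_mk, Polynomial.coeff_coe] at this
  rw [← this]
  rcases n with _ | n
  · simp
  · rw [PowerSeries.coeff_succ_X_mul]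
    simp [PowerSeries.coeff_derivative, mul_comm]

lemma coeff_zero_ofInvRoots (M : Multiset ℂˣ) : (ofInvRoots M).coeff 0 = 1 := by
  induction M using Multiset.induction_on with
  | empty => simp [ofInvRoots]
  | cons c M ih => simp_all [ofInvRoots, Polynomial.mul_coeff_zero]

lemma ofInvRoots_add (M M' : Multiset ℂˣ) :
    ofInvRoots (M + M') = ofInvRoots M * ofInvRoots M' := by
  simp [ofInvRoots]

lemma ofInvRoots_cons (c : ℂˣ) (M : Multiset ℂˣ) :
    ofInvRoots (c ::ₘ M) =
      (1 - Polynomial.C (c : ℂ) * Polynomial.X) * ofInvRoots M := by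
  simp [ofInvRoots]

lemma ofInvRoots_ne_zero (M : Multiset ℂˣ) : ofInvRoots M ≠ 0 := fun h => by
  simpa [h] using coeff_zero_ofInvRoots M

open Polynomial in
lemma natDegree_one_sub (c : ℂˣ) : (1 - C (c : ℂ) * X).natDegree = 1 := by
  have : (1 - C (c : ℂ) * X) = C (-(c : ℂ)) * X + C 1 := by simp; ring
  rw [this, natDegree_linear (by simp)]

open Polynomial in
lemma natDegree_ofInvRoots (M : Multiset ℂˣ) : (ofInvRoots M).natDegree = M.card := by
  induction M using Multiset.induction_on with
  | empty => simp [ofInvRoots]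
  | cons c M ih =>
    have h : (1 - C (c : ℂ) * X) ≠ 0 := fun h => by
      simpa [h] using natDegree_one_sub c
    rw [ofInvRoots_cons, natDegree_mul h (ofInvRoots_ne_zero M), ih, natDegree_one_sub,
      Multiset.card_cons, add_comm]

open Polynomial DiagramAut in
lemma signPoly_ofInvRoots (s : ℤˣ) (M : Multiset ℂˣ) :
    signPoly s (ofInvRoots M) = ofInvRoots (M.map (· ^ (s : ℤ))) := by
  rcases Int.units_eq_one_or s with rfl | rfl
  · simp [signPoly]
  rw [signPoly, if_neg (by decide)]
  induction M using Multiset.induction_on with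
  | empty => simpa [ofInvRoots] using reverse_C (1 : ℂ)
  | cons c M ih =>
    have h0 : (1 - C (c : ℂ) * X) = C (-(c : ℂ)) * X + C 1 := by simp; ring
    have h1 : (1 - C (c : ℂ) * X).leadingCoeff = -(c : ℂ) := by
      rw [h0, leadingCoeff_linear (by simp)]
    have h2 : (1 - C (c : ℂ) * X).reverse = X - C (c : ℂ) := by
      rw [reverse, natDegree_one_sub, h0, reflect_add, reflect_C]
      have := reflect_C_mul_X_pow 1 1 (c := -(c : ℂ))
      rw [pow_one] at this
      rw [this]
      simp [revAt_le]
      ring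
    rw [ofInvRoots_cons, Multiset.map_cons, ofInvRoots_cons, ← ih, leadingCoeff_mul,
      reverse_mul_of_domain, h1, h2, mul_inv, C_mul]
    have h3 : (1 - C (((c ^ ((-1 : ℤˣ) : ℤ) : ℂˣ) : ℂ)) * X) = C (-(c : ℂ))⁻¹ * (X - C (c : ℂ)) := by
      rw [mul_sub, ← C_mul, inv_neg, neg_mul, inv_mul_cancel₀ c.ne_zero]
      simp
      ring
    rw [h3]
    ring

lemma powerSum_map_zpow (M : Multiset ℂˣ) (s k : ℤ) :
    powerSum (M.map (· ^ s)) k = powerSum M (s * k) := by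
  simp only [powerSum, Multiset.map_map, Function.comp_def, zpow_mul]

/-! ### Logarithms acting on a vector, and the Garland-type computation. -/

section Module

variable {A V : Type*} [Ring A] [Algebra ℂ A] [AddCommGroup V] [Module A V] [Module ℂ V]
  [IsScalarTower ℂ A V]

open DiagramAut in
/-- If `exp F` acts on `w` as `∏_c (1 - c u)`, then `F` acts as its logarithm. -/
lemma coeff_smul_of_psExp (F : PowerSeries A) (h0 : PowerSeries.constantCoeff F = 0)
    (hF : ∀ i j, Commute (PowerSeries.coeff i F) (PowerSeries.coeff j F))
    (M : Multiset ℂˣ) (w : V)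
    (h : ∀ n, PowerSeries.coeff n (psExp F) • w = (ofInvRoots M).coeff n • w) (n : ℕ)
    (hn : n ≠ 0) : PowerSeries.coeff n F • w = (-(powerSum M n) / n) • w := by
  -- g k measures the failure of the claim in degree k. Subtracting the two recursions gives ∑
  -- e_{k-j} g j = 0 with e_0 = 1, so induction leaves only g k.
  let g : ℕ → V := fun k =>
    (k : ℂ) • PowerSeries.coeff k F • w + (if k = 0 then 0 else powerSum M k) • w
  suffices H : ∀ k, g k = 0 by
    have h1 := H n
    simp only [g, if_neg hn] at h1
    have hn' : (n : ℂ) ≠ 0 := by exact_mod_cast hn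
    rw [div_eq_inv_mul, mul_smul, neg_smul, ← eq_neg_of_add_eq_zero_left h1, smul_smul,
      inv_mul_cancel₀ hn', one_smul]
  intro k
  induction k using Nat.strong_induction_on with
  | _ k ih =>
    have h1 := congrArg (· • w) (natCast_mul_coeff_psExp F h0 hF k)
    have h2 := congrArg (· • w) (natCast_mul_coeff_ofInvRoots M k)
    simp only [mul_smul, Finset.sum_smul, h, neg_smul, smul_comm _ (Polynomial.coeff _ _)] at h1 h2
    have h3 : ∀ (j : ℕ) (v : V), (j : A) • v = (j : ℂ) • v := fun j v => by
      rw [Nat.cast_smul_eq_nsmul, Nat.cast_smul_eq_nsmul]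
    simp only [h3] at h1
    have h4 : ∑ p ∈ antidiagonal k, (ofInvRoots M).coeff p.2 • g p.1 = 0 := by
      simp only [g, smul_add, Finset.sum_add_distrib]
      rw [← eq_neg_iff_add_eq_zero, ← h2, ← h1]
    rw [Finset.sum_eq_single (k, 0)] at h4
    · simpa [coeff_zero_ofInvRoots] using h4
    · rintro ⟨i, j⟩ hp hne
      have hij := mem_antidiagonal.1 hp
      rw [ih i (by
        rcases Nat.eq_zero_or_pos j with rfl | hj
        · exact absurd (by simpa using hij) (by simpa using hne)
        · simp only at hij; omega), smul_zero]
    · intro hk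
      exact absurd (mem_antidiagonal.2 (by simp)) hk

/-- Moving x through F^{k+2} creates one α h for each factor, and moving each h to the right creates
β D for each factor passed. The factor 2 clears the binomial coefficient counting pairs of factors.
-/
lemma two_smul_mul_pow_eq (x h F D : A) (α β : ℂ) (hx : x * F = F * x + α • h)
    (hF : h * F = F * h + β • D) (hD : Commute D F) (k : ℕ) :
    (2 : ℂ) • (x * F ^ (k + 2)) = (2 : ℂ) • (F ^ (k + 2) * x) +
      (2 * α * (k + 2)) • (F ^ (k + 1) * h) + (α * β * (k + 1) * (k + 2)) • (F ^ k * D) := by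
  induction k with
  | zero =>
    have h1 : x * F ^ 2 = F ^ 2 * x + (α * 2) • (F * h) + (α * β) • D := by
      rw [sq, ← mul_assoc, hx, add_mul, mul_assoc, hx, mul_add, smul_mul_assoc, hF, smul_add,
        smul_smul, mul_smul_comm, mul_assoc, mul_two, add_smul]
      abel
    rw [zero_add, h1]
    simp only [pow_zero, one_mul, pow_one, zero_add, Nat.cast_zero]
    module
  | succ k ih =>
    rw [pow_succ F (k + 2), ← mul_assoc, ← smul_mul_assoc, ih]
    simp only [add_mul, smul_mul_assoc]
    rw [mul_assoc, hx, mul_assoc (F ^ (k + 1)), hF, mul_assoc (F ^ k), hD.eq]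
    simp only [mul_add, smul_add, mul_smul_comm, ← mul_assoc, ← pow_succ, smul_smul]
    push_cast
    module

/-- If `[X, Y_j] = α H_{j+1}`, `[H_i, Y_j] = β Y_{i+j}` and the `Y_j` commute, then `X` acts on
`(∑ Y_j u^j)^k w` as a multiple of the derivative of `(∑ Y_j u^j)^{k-1} w`, for `w` killed by `X`
and the `H_{j+1}`. -/
lemma smul_coeff_pow (X : A) (Y H : ℕ → A) (α β : ℂ)
    (hXY : ∀ j, X * Y j = Y j * X + α • H (j + 1))
    (hHY : ∀ i j, H i * Y j = Y j * H i + β • Y (i + j))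
    (hY : ∀ i j, Commute (Y i) (Y j)) (w : V) (hX : X • w = 0) (hH : ∀ j, H (j + 1) • w = 0)
    (k r : ℕ) :
    (2 : ℂ) • X • PowerSeries.coeff r (PowerSeries.mk Y ^ (k + 1)) • w =
      (α * β * (k + 1) * (r + 1) : ℂ) •
        PowerSeries.coeff (r + 1) (PowerSeries.mk Y ^ k) • w := by
  let F : PowerSeries A := PowerSeries.mk Y
  let h : PowerSeries A := PowerSeries.mk fun j => H (j + 1)
  -- D is the derivative F'. It arises because [H_{i+1}, Y_j] depends only on i + j, so the n + 1
  -- terms of a coefficient of [h, F] coincide.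
  let D : PowerSeries A := PowerSeries.mk fun j => ((j + 1 : ℕ) : A) * Y (j + 1)
  have hx : PowerSeries.C X * F = F * PowerSeries.C X + α • h := by
    ext n
    simp [F, h, hXY]
  have hF : h * F = F * h + β • D := by
    ext n
    rw [map_add, PowerSeries.coeff_mul, PowerSeries.coeff_mul, ← Finset.Nat.sum_antidiagonal_swap]
    simp only [F, h, D, PowerSeries.coeff_mk, Prod.fst_swap, Prod.snd_swap, hHY,
      Finset.sum_add_distrib, add_right_inj]
    have : ∀ p ∈ antidiagonal n, β • Y (p.2 + 1 + p.1) = β • Y (n + 1) := by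
      intro p hp
      rw [← mem_antidiagonal.1 hp]
      congr 2
      ring
    rw [Finset.sum_congr rfl this]
    simp
  have hD : Commute D F := by
    ext n
    rw [PowerSeries.coeff_mul, PowerSeries.coeff_mul, ← Finset.Nat.sum_antidiagonal_swap]
    refine Finset.sum_congr rfl fun p _ => ?_
    simp only [F, D, PowerSeries.coeff_mk, Prod.fst_swap, Prod.snd_swap]
    rw [mul_assoc, (hY _ _).eq, ← mul_assoc, ← mul_assoc, (Nat.cast_commute _ _).eq]
  have hsm : ∀ (n : ℕ) (c : ℂ) (G : PowerSeries A),
      PowerSeries.coeff n (c • G) = c • PowerSeries.coeff n G := fun _ _ _ => rfl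
  have hCX : ∀ (G : PowerSeries A) (n : ℕ), PowerSeries.coeff n (G * PowerSeries.C X) • w = 0 := by
    intro G n
    rw [PowerSeries.coeff_mul_C, mul_smul, hX, smul_zero]
  have hCh : ∀ (G : PowerSeries A) (n : ℕ), PowerSeries.coeff n (G * h) • w = 0 := by
    intro G n
    rw [PowerSeries.coeff_mul, Finset.sum_smul]
    refine Finset.sum_eq_zero fun p _ => ?_
    rw [mul_smul, PowerSeries.coeff_mk, hH, smul_zero]
  rcases k with _ | k
  · have h1 := congrArg (fun G => PowerSeries.coeff r G • w) hx
    simp only [map_add, add_smul, hCX, hsm, smul_assoc, PowerSeries.coeff_C_mul, mul_smul] at h1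
    rw [zero_add, pow_one, h1]
    simp [h, hH]
  · have h1 := congrArg (fun G => PowerSeries.coeff r G • w)
      (two_smul_mul_pow_eq (PowerSeries.C X) h F D α β hx hF hD k)
    simp only [map_add, add_smul, hsm, smul_assoc, hCX, hCh, smul_zero, zero_add,
      PowerSeries.coeff_C_mul] at h1
    rw [← mul_smul X]
    refine h1.trans ?_
    -- Only the term F^k D survives on w, and (k + 1) F^k D is the derivative of F^{k+1}.
    have h2 := congrArg (· • w) (natCast_mul_coeff_pow_succ F (by simpa [F] using hY) k (r + 1))
    have h3 : ∑ p ∈ antidiagonal (r + 1), (p.1 : A) * PowerSeries.coeff p.1 F *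
        PowerSeries.coeff p.2 (F ^ k) = PowerSeries.coeff r (F ^ k * D) := by
      rw [← (hD.pow_right k).eq, PowerSeries.coeff_mul, Finset.Nat.antidiagonal_succ]
      simp [F, D]
    rw [h3] at h2
    have h4 : ∀ (j : ℕ) (a : A), ((j : A) * a) • w = (j : ℂ) • a • w := fun j a => by
      rw [mul_smul, Nat.cast_smul_eq_nsmul, Nat.cast_smul_eq_nsmul]
    simp only [h4] at h2
    have e1 : (α * β * (k + 1) * (k + 2) : ℂ) = α * β * (k + 2) * ((k + 1 : ℕ) : ℂ) := by
      push_cast; ring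
    have e2 : (α * β * (((k + 1 : ℕ) : ℂ) + 1) * (r + 1) : ℂ) =
        α * β * (k + 2) * ((r + 1 : ℕ) : ℂ) := by
      push_cast; ring
    rw [e1, e2, mul_smul _ ((k + 1 : ℕ) : ℂ), mul_smul _ ((r + 1 : ℕ) : ℂ), ← h2]

/-- If `X` and `Y₀` are as in `smul_coeff_pow` and `Y₀^{n+1} w = 0`, then `Y_n w = 0`. -/
lemma smul_eq_zero_of_pow_smul_eq_zero (X : A) (Y H : ℕ → A) (α β : ℂ) (hα : α ≠ 0) (hβ : β ≠ 0)
    (hXY : ∀ j, X * Y j = Y j * X + α • H (j + 1))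
    (hHY : ∀ i j, H i * Y j = Y j * H i + β • Y (i + j))
    (hY : ∀ i j, Commute (Y i) (Y j)) (w : V) (hX : X • w = 0) (hH : ∀ j, H (j + 1) • w = 0)
    (n : ℕ) (hn : Y 0 ^ (n + 1) • w = 0) : Y n • w = 0 := by
  -- Each application of X lowers the power of ∑ Y_j u^j by one and raises the degree by one: r = 0
  -- is Y_0^{n+1}, and r = n is Y_n.
  have key : ∀ r ≤ n, PowerSeries.coeff r (PowerSeries.mk Y ^ (n - r + 1)) • w = 0 := by
    intro r hr
    induction r with
    | zero => rw [Nat.sub_zero, PowerSeries.coeff_zero_eq_constantCoeff_apply, map_pow,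
        ← PowerSeries.coeff_zero_eq_constantCoeff_apply, PowerSeries.coeff_mk, hn]
    | succ r ih =>
      have h1 := smul_coeff_pow X Y H α β hXY hHY hY w hX hH (n - r) r
      rw [ih (by omega), smul_zero, smul_zero, eq_comm] at h1
      have h2 : n - r = n - (r + 1) + 1 := by omega
      rw [← h2]
      refine (smul_eq_zero_iff_right ?_).1 h1
      have h3 : ((n - r : ℕ) : ℂ) + 1 ≠ 0 := by exact_mod_cast (n - r).succ_ne_zero
      have h4 : (r : ℂ) + 1 ≠ 0 := by exact_mod_cast r.succ_ne_zero
      exact mul_ne_zero (mul_ne_zero (mul_ne_zero hα hβ) h3) h4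
  simpa using key n le_rfl

end Module

/-! ### The Cartan matrix and the action of σ on the nodes. -/

variable {g I : Type*} [LieRing g] [LieAlgebra ℂ g] [Fintype I] {H : LieSubalgebra ℂ g}

/-- The Cartan matrix of a simple Lie algebra is positive definite up to a positive diagonal
factor. -/
lemma exists_mul_diagonal_posDef [FiniteDimensional ℂ g] [LieAlgebra.IsSimple ℂ g] [DecidableEq I]
    (b : LieAlgebra.Basis I H) :
    ∃ d : I → ℤ, (∀ i, 0 < d i) ∧ (b.A * Matrix.diagonal d).PosDef := by
  let := b.isCartanSubalgebra
  classical
  obtain ⟨d, hd, h⟩ := b.base.exists_cartanMatrix_mul_diagaonal_posDef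
  refine ⟨d ∘ b.baseSupportEquiv, fun i => hd _, ?_⟩
  convert h.submatrix b.baseSupportEquiv.injective using 1
  ext i j
  simp [b.cartanMatrix_base_eq]

/-- Symmetrizability gives A i j * d j = A j i * d i with d positive, so the two off-diagonal
entries vanish together; in the simply laced case the only other value is -1. -/
lemma A_comm_of_isSimplyLaced [FiniteDimensional ℂ g] [LieAlgebra.IsSimple ℂ g] [DecidableEq I]
    (b : LieAlgebra.Basis I H) (hb : b.A.IsSimplyLaced) (i j : I) : b.A i j = b.A j i := by
  rcases eq_or_ne i j with rfl | hij
  · rfl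
  obtain ⟨d, hd, h⟩ := exists_mul_diagonal_posDef b
  have h1 := h.isHermitian.apply i j
  simp only [Matrix.mul_diagonal, star_trivial] at h1
  have hi := hd i
  have hj := hd j
  rcases hb hij with h2 | h2 <;> rcases hb hij.symm with h3 | h3 <;> 
    simp only [h2, h3] at h1 ⊢ <;> omega

namespace DiagramAut

variable {b : LieAlgebra.Basis I H} (σ : DiagramAut b)

lemma A_perm (i j : I) : b.A (σ.perm i) (σ.perm j) = b.A i j := by
  have h := congrArg σ.toLieEquiv (b.lie_h_e i j)
  rw [LieEquiv.map_lie, σ.map_h, σ.map_e, b.lie_h_e, map_zsmul, σ.map_e, ← sub_eq_zero,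
    ← sub_smul] at h
  have : IsAddTorsionFree g := .of_isTorsionFree ℂ g
  rwa [IsAddTorsionFree.zsmul_eq_zero_iff_left (b.sl2 _).e_ne_zero, sub_eq_zero] at h

lemma A_perm_pow (l : ℕ) (i j : I) : b.A ((σ.perm ^ l) i) ((σ.perm ^ l) j) = b.A i j := by
  induction l with
  | zero => simp
  | succ l ih => rw [pow_succ', Equiv.Perm.mul_apply, Equiv.Perm.mul_apply, A_perm, ih]

/-- Summation over a period does not depend on the starting point. -/
lemma sum_range_order_add {M : Type*} [AddCommMonoid M] (F : ℕ → M)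
    (hF : ∀ l, F (l + σ.order) = F l) (k : ℕ) :
    ∑ l ∈ Finset.range σ.order, F (l + k) = ∑ l ∈ Finset.range σ.order, F l := by
  induction k with
  | zero => simp
  | succ k ih =>
    rw [← ih]
    have h1 := Finset.sum_range_succ (fun l => F (l + k)) σ.order
    have h2 := Finset.sum_range_succ' (fun l => F (l + k)) σ.order
    obtain ⟨n, hn⟩ := Nat.exists_eq_succ_of_ne_zero σ.order_pos.ne'
    rw [hn, Finset.sum_range_succ, Finset.sum_range_succ']
    congr 1
    · exact Finset.sum_congr rfl fun l _ => by congr 1; omega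
    · rw [← hF (0 + k), hn]; congr 1; omega

variable [FiniteDimensional ℂ g] [LieAlgebra.IsSimple ℂ g] [DecidableEq I]

/-- The sum of the entries `⟨α_{i}, α_{σ^l(i)}⟩`, `0 ≤ l < m`, is positive. -/
lemma sum_A_pos (i : I) : 0 < ∑ l ∈ Finset.range σ.order, b.A ((σ.perm ^ l) i) i := by
  obtain ⟨d, hd, h⟩ := exists_mul_diagonal_posDef b
  -- The positive definite form is evaluated at the sum of the nodes σ^l(i). By σ-invariance all
  -- column sums agree, and the value is the desired sum times a sum of the d's.
  let x : I → ℤ := ∑ l ∈ Finset.range σ.order, Pi.single ((σ.perm ^ l) i) 1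
  have hx : x ≠ 0 := by
    intro h0
    have h1 := congrArg (fun y : I → ℤ => ∑ j, y j) h0
    simp [x, Finset.sum_apply, Finset.sum_comm (s := Finset.univ), σ.order_pos.ne'] at h1
  have h1 := h.dotProduct_mulVec_pos hx
  have h2 : star x ⬝ᵥ ((b.A * Matrix.diagonal d) *ᵥ x) =
      ∑ k ∈ Finset.range σ.order, ∑ l ∈ Finset.range σ.order,
        b.A ((σ.perm ^ l) i) ((σ.perm ^ k) i) * d ((σ.perm ^ k) i) := by
    simp only [x, star_trivial, Matrix.mulVec_sum, dotProduct_sum, sum_dotProduct]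
    simp
  have h3 : ∀ k ∈ Finset.range σ.order, ∑ l ∈ Finset.range σ.order,
      b.A ((σ.perm ^ l) i) ((σ.perm ^ k) i) * d ((σ.perm ^ k) i) =
      (∑ l ∈ Finset.range σ.order, b.A ((σ.perm ^ l) i) i) * d ((σ.perm ^ k) i) := by
    intro k _
    rw [Finset.sum_mul, ← σ.sum_range_order_add _ _ k]
    · refine Finset.sum_congr rfl fun l _ => ?_
      rw [add_comm l k, pow_add, Equiv.Perm.mul_apply, A_perm_pow]
    · intro l
      rw [pow_add, order, pow_orderOf_eq_one, mul_one]
  rw [h2, Finset.sum_congr rfl h3, ← Finset.mul_sum] at h1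
  exact pos_of_mul_pos_left h1 (Finset.sum_nonneg fun k _ => (hd _).le)

/-- If i were joined to σ(i) with σ²(i) ≠ i, then σ(i) and σ⁻¹(i) would be two distinct neighbours
of i in its orbit. They cancel the diagonal entry 2, contradicting `sum_A_pos`. -/
lemma perm_perm_of_isMiddle (hb : b.A.IsSimplyLaced) {i : I} (hi : σ.IsMiddle i) :
    σ.perm (σ.perm i) = i := by
  by_contra h2
  have h1 : σ.perm i ≠ i := by
    intro h
    have := hi
    have h3 : IsAddTorsionFree g := .of_isTorsionFree ℂ g
    rw [IsMiddle, h, b.A_diag_eq_two] at this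
    omega
  let F : ℕ → ℤ := fun l => b.A ((σ.perm ^ l) i) i
  let χ : ℕ → ℤ := fun l => if (σ.perm ^ l) i = i then 1 else 0
  have hper : ∀ l, σ.perm ^ (l + σ.order) = σ.perm ^ l := fun l => by
    rw [pow_add, order, pow_orderOf_eq_one, mul_one]
  have hs : ∀ (n l : ℕ), (σ.perm ^ (l + n)) i = (σ.perm ^ n) ((σ.perm ^ l) i) := fun n l => by
    rw [add_comm, pow_add, Equiv.Perm.mul_apply]
  -- The contributions 2, -1, -1 come from σ^{l+1}(i) being i, σ(i), σ⁻¹(i); all other entries are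
  -- at most 0. Over a period the three shifted sums of χ are equal and cancel.
  have hle : ∀ l, F (l + 1) ≤ 2 * χ (l + 1) - χ l - χ (l + 2) := by
    intro l
    have e1 := hs 1 l
    have e2 := hs 2 l
    rw [pow_one] at e1
    rw [sq, Equiv.Perm.mul_apply] at e2
    have h3 : IsAddTorsionFree g := .of_isTorsionFree ℂ g
    simp only [F, χ, e1, e2]
    generalize (σ.perm ^ l) i = j
    by_cases h4 : j = i
    · subst h4
      have : b.A (σ.perm j) j = -1 := by rw [A_comm_of_isSimplyLaced b hb]; exact hi
      rw [this]
      simp [h1, h2]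
    · by_cases h5 : σ.perm j = i
      · rw [h5]
        simp [h4, h1]
      · by_cases h6 : σ.perm (σ.perm j) = i
        · have : b.A (σ.perm j) i = -1 := by
            rw [← σ.A_perm, h6]; exact hi
          rw [this]
          simp [h4, h5, h6]
        · simp only [h4, h5, h6, if_false]
          rcases hb h5 with h | h <;> omega
  have h3 := Finset.sum_le_sum fun l (_ : l ∈ Finset.range σ.order) => hle l
  simp only [Finset.sum_sub_distrib, ← Finset.mul_sum] at h3
  have hχ : ∀ l, χ (l + σ.order) = χ l := fun l => by simp only [χ, hper]
  rw [σ.sum_range_order_add χ hχ 1, σ.sum_range_order_add χ hχ 2,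
    σ.sum_range_order_add F (fun l => by simp only [F, hper]) 1] at h3
  have := σ.sum_A_pos i
  simp only [F] at h3
  omega

/-- A node joined to its image lies in an orbit with two elements, so that `m` is even. -/
lemma even_order_of_isMiddle (hb : b.A.IsSimplyLaced) {i : I} (hi : σ.IsMiddle i) :
    Even σ.order := by
  by_contra hodd
  obtain ⟨k, hk⟩ := Nat.not_even_iff_odd.1 hodd
  have h2 : ∀ k : ℕ, (σ.perm ^ (2 * k)) i = i := by
    intro k
    induction k with
    | zero => simp
    | succ k ih =>
      rw [mul_add, pow_add, Equiv.Perm.mul_apply, mul_one, sq, Equiv.Perm.mul_apply,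
        σ.perm_perm_of_isMiddle hb hi, ih]
  have h1 : (σ.perm ^ σ.order) i = i := by rw [order, pow_orderOf_eq_one]; rfl
  rw [hk, pow_succ', Equiv.Perm.mul_apply, h2] at h1
  have h3 : IsAddTorsionFree g := .of_isTorsionFree ℂ g
  rw [IsMiddle, h1, b.A_diag_eq_two] at hi
  omega

end DiagramAut

namespace DiagramAut

variable {b : LieAlgebra.Basis I H} (σ : DiagramAut b)

/-- Positive entries occur only where σ^l fixes i, and there z^l = 1. The other entries are at most
0 and Re z^l ≤ 1, so the real part is at least the sum in `sum_A_pos`. This replaces α_i(h_i) = 2 ≠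
0 in the untwisted case. -/
lemma sum_A_mul_pow_ne_zero [FiniteDimensional ℂ g] [LieAlgebra.IsSimple ℂ g] [DecidableEq I]
    (hb : b.A.IsSimplyLaced) (i : I) (z : ℂ) (hz : ‖z‖ = 1)
    (h : ∀ l, (σ.perm ^ l) i = i → z ^ l = 1) :
    ∑ l ∈ Finset.range σ.order, (b.A ((σ.perm ^ l) i) i : ℂ) * z ^ l ≠ 0 := by
  intro h0
  have h1 : ∀ l ∈ Finset.range σ.order, ((b.A ((σ.perm ^ l) i) i : ℤ) : ℝ) ≤
      ((b.A ((σ.perm ^ l) i) i : ℂ) * z ^ l).re := by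
    intro l _
    rw [← Complex.ofReal_intCast, Complex.re_ofReal_mul]
    by_cases hl : (σ.perm ^ l) i = i
    · rw [h l hl]; simp
    · have h2 : (z ^ l).re ≤ 1 := (Complex.re_le_norm _).trans (by rw [norm_pow, hz, one_pow])
      have h3 : ((b.A ((σ.perm ^ l) i) i : ℤ) : ℝ) ≤ 0 := by
        rcases hb hl with h | h <;> simp [h]
      nlinarith
  have h2 := Finset.sum_le_sum h1
  rw [← Complex.re_sum, h0, Complex.zero_re] at h2
  have h3 := σ.sum_A_pos i
  exact absurd (by exact_mod_cast h2) (not_le.2 h3)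

/-! ### Iterates of `σ` -/

lemma iterate_lie (l : ℕ) (x y : g) :
    σ.toLieEquiv^[l] ⁅x, y⁆ = ⁅σ.toLieEquiv^[l] x, σ.toLieEquiv^[l] y⁆ := by
  induction l with
  | zero => rfl
  | succ l ih => simp only [Function.iterate_succ_apply', ih, LieEquiv.map_lie]

lemma iterate_apply_of_perm (y : I → g) (hy : ∀ i, σ.toLieEquiv (y i) = y (σ.perm i)) (l : ℕ)
    (i : I) : σ.toLieEquiv^[l] (y i) = y ((σ.perm ^ l) i) := by
  induction l with
  | zero => rfl
  | succ l ih => rw [Function.iterate_succ_apply', ih, hy, pow_succ', Equiv.Perm.mul_apply]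

/-- `order` is the order of the permutation of the nodes, so the identity is checked on the e_i and
f_i, which generate g. -/
lemma iterate_order (x : g) : σ.toLieEquiv^[σ.order] x = x := by
  have hx : x ∈ LieSubalgebra.lieSpan ℂ g (Set.range b.e ∪ Set.range b.f) := by
    rw [b.span_ef]; trivial
  have hp : σ.perm ^ σ.order = 1 := pow_orderOf_eq_one _
  have hlin : ∀ l : ℕ, ∃ φ : g →ₗ[ℂ] g, ∀ x, φ x = σ.toLieEquiv^[l] x := fun l =>
    ⟨(σ.toLieEquiv.toLinearEquiv : g →ₗ[ℂ] g) ^ l, fun x => by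
      rw [Module.End.pow_apply]; rfl⟩
  obtain ⟨φ, hφ⟩ := hlin σ.order
  induction hx using LieSubalgebra.lieSpan_induction with
  | mem x hx =>
    rcases hx with ⟨i, rfl⟩ | ⟨i, rfl⟩
    · rw [σ.iterate_apply_of_perm b.e σ.map_e, hp]; rfl
    · rw [σ.iterate_apply_of_perm b.f σ.map_f, hp]; rfl
  | zero => rw [← hφ, map_zero]
  | add x y _ _ hx hy => rw [← hφ, map_add, hφ, hφ, hx, hy]
  | smul c x _ hx => rw [← hφ, map_smul, hφ, hx]
  | lie x y _ _ hx hy => rw [iterate_lie, hx, hy]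

/-! ### The projection onto the twisted loop algebra -/

variable {ζ : ℂ} (hζ : IsPrimitiveRoot ζ σ.order)

/-- The element `r(t^m)` of `ℂ[t, t⁻¹]`. -/
abbrev polyT (r : Polynomial ℂ) : ℂ[T;T⁻¹] :=
  Polynomial.aeval (LaurentPolynomial.T (σ.order : ℤ) : ℂ[T;T⁻¹]) r

lemma scale_polyT (r : Polynomial ℂ) :
    scale (hζ.ne_zero σ.order_pos.ne') (σ.polyT r) = σ.polyT r := by
  rw [polyT, ← Polynomial.aeval_algHom_apply, scale_T, zpow_natCast, hζ.pow_eq_one, one_smul]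

lemma twist_pow_tmul (l : ℕ) (k : ℤ) (r : Polynomial ℂ) (x : g) :
    ((σ.twist hζ : LieAlgebra.loopAlgebra ℂ ℤ g →ₗ[ℂ] LieAlgebra.loopAlgebra ℂ ℤ g) ^ l)
      ((LaurentPolynomial.T k * σ.polyT r) ⊗ₜ[ℂ] x) =
    ζ ^ (l * k) • ((LaurentPolynomial.T k * σ.polyT r) ⊗ₜ[ℂ] σ.toLieEquiv^[l] x) := by
  induction l with
  | zero => simp
  | succ l ih =>
    rw [pow_succ', Module.End.mul_apply, ih, map_smul, Function.iterate_succ_apply']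
    change ζ ^ _ • σ.twist hζ _ = _
    rw [twist_tmul, map_mul, scale_polyT (hζ := hζ), scale_T, smul_mul_assoc, ← TensorProduct.smul_tmul',
      smul_smul, ← zpow_add₀ (hζ.ne_zero σ.order_pos.ne')]
    congr 2
    push_cast
    ring

lemma twist_pow_lie (l : ℕ) (x y : LieAlgebra.loopAlgebra ℂ ℤ g) :
    ((σ.twist hζ : LieAlgebra.loopAlgebra ℂ ℤ g →ₗ[ℂ] LieAlgebra.loopAlgebra ℂ ℤ g) ^ l) ⁅x, y⁆ =
      ⁅((σ.twist hζ : LieAlgebra.loopAlgebra ℂ ℤ g →ₗ[ℂ] LieAlgebra.loopAlgebra ℂ ℤ g) ^ l) x,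
       ((σ.twist hζ : LieAlgebra.loopAlgebra ℂ ℤ g →ₗ[ℂ] LieAlgebra.loopAlgebra ℂ ℤ g) ^ l) y⁆ := by
  induction l with
  | zero => rfl
  | succ l ih =>
    simp only [pow_succ', Module.End.mul_apply, ih]
    exact LieHom.map_lie _ _ _

/-- The elements `t^k ⊗ x` span the loop algebra. -/
lemma loop_induction {p : LieAlgebra.loopAlgebra ℂ ℤ g → Prop}
    (T : ∀ (k : ℤ) (x : g), p ((LaurentPolynomial.T k : ℂ[T;T⁻¹]) ⊗ₜ[ℂ] x)) (zero : p 0)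
    (add : ∀ x y, p x → p y → p (x + y)) (z : LieAlgebra.loopAlgebra ℂ ℤ g) : p z := by
  induction z using TensorProduct.induction_on with
  | zero => exact zero
  | add x y hx hy => exact add x y hx hy
  | tmul f x =>
    induction f using LaurentPolynomial.induction_on' with
    | add f f' hf hf' => rw [TensorProduct.add_tmul]; exact add _ _ hf hf'
    | C_mul_T n a =>
      rw [← LaurentPolynomial.smul_eq_C_mul, TensorProduct.smul_tmul]
      exact T n _

lemma twist_pow_order (z : LieAlgebra.loopAlgebra ℂ ℤ g) :
    ((σ.twist hζ : LieAlgebra.loopAlgebra ℂ ℤ g →ₗ[ℂ] LieAlgebra.loopAlgebra ℂ ℤ g) ^ σ.order) z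
      = z := by
  induction z using loop_induction with
  | T k x =>
    have := σ.twist_pow_tmul hζ σ.order k 1 x
    rw [polyT, map_one, mul_one, iterate_order, zpow_mul, zpow_natCast, hζ.pow_eq_one, one_zpow,
      one_smul] at this
    exact this
  | zero => exact map_zero _
  | add x y hx hy => rw [map_add, hx, hy]

/-- The map `∑_{0 ≤ l < m} σ̃^l` from the loop algebra onto the twisted loop algebra. -/
def tr : LieAlgebra.loopAlgebra ℂ ℤ g →ₗ[ℂ] σ.twistedLoop hζ :=
  LinearMap.codRestrict (σ.twistedLoop hζ).toSubmodule
    (∑ l ∈ Finset.range σ.order,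
      (σ.twist hζ : LieAlgebra.loopAlgebra ℂ ℤ g →ₗ[ℂ] LieAlgebra.loopAlgebra ℂ ℤ g) ^ l)
    (fun z => by
      change σ.twist hζ _ = _
      rw [LinearMap.sum_apply, map_sum]
      have h1 := σ.sum_range_order_add (fun l =>
        ((σ.twist hζ : LieAlgebra.loopAlgebra ℂ ℤ g →ₗ[ℂ] LieAlgebra.loopAlgebra ℂ ℤ g) ^ l) z)
        (fun l => by rw [pow_add, Module.End.mul_apply, twist_pow_order]) 1
      rw [← h1]
      refine Finset.sum_congr rfl fun l _ => ?_
      rw [pow_succ', Module.End.mul_apply]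
      rfl)

lemma coe_tr (z : LieAlgebra.loopAlgebra ℂ ℤ g) :
    (σ.tr hζ z : LieAlgebra.loopAlgebra ℂ ℤ g) = ∑ l ∈ Finset.range σ.order,
      ((σ.twist hζ : LieAlgebra.loopAlgebra ℂ ℤ g →ₗ[ℂ] LieAlgebra.loopAlgebra ℂ ℤ g) ^ l) z := by
  rw [← LinearMap.sum_apply]
  rfl

lemma tr_twist (z : LieAlgebra.loopAlgebra ℂ ℤ g) : σ.tr hζ (σ.twist hζ z) = σ.tr hζ z := by
  apply Subtype.ext
  rw [coe_tr, coe_tr, ← σ.sum_range_order_add (fun l =>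
        ((σ.twist hζ : LieAlgebra.loopAlgebra ℂ ℤ g →ₗ[ℂ] LieAlgebra.loopAlgebra ℂ ℤ g) ^ l) z)
        (fun l => by rw [pow_add, Module.End.mul_apply, twist_pow_order]) 1]
  rfl

lemma twist_pow_coe (l : ℕ) (y : σ.twistedLoop hζ) :
    ((σ.twist hζ : LieAlgebra.loopAlgebra ℂ ℤ g →ₗ[ℂ] LieAlgebra.loopAlgebra ℂ ℤ g) ^ l)
      (y : LieAlgebra.loopAlgebra ℂ ℤ g) = y := by
  induction l with
  | zero => rfl
  | succ l ih => rw [pow_succ', Module.End.mul_apply, ih]; exact y.2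

/-- σ̃ respects brackets and fixes y. Hence `tr` carries the ideal Q·L(g) to an ideal of the twisted
algebra. -/
lemma lie_tr (z : LieAlgebra.loopAlgebra ℂ ℤ g) (y : σ.twistedLoop hζ) :
    ⁅σ.tr hζ z, y⁆ = σ.tr hζ ⁅z, (y : LieAlgebra.loopAlgebra ℂ ℤ g)⁆ := by
  apply Subtype.ext
  rw [LieSubalgebra.coe_bracket, coe_tr, coe_tr, sum_lie]
  refine Finset.sum_congr rfl fun l _ => ?_
  rw [twist_pow_lie, twist_pow_coe]

/-- The element `∑_l σ̃^l (t^k r(t^m) ⊗ x)` of the twisted loop algebra. -/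
def elt (k : ℤ) (r : Polynomial ℂ) (x : g) : σ.twistedLoop hζ :=
  σ.tr hζ ((LaurentPolynomial.T k * σ.polyT r) ⊗ₜ[ℂ] x)

lemma coe_elt (k : ℤ) (r : Polynomial ℂ) (x : g) :
    (σ.elt hζ k r x : LieAlgebra.loopAlgebra ℂ ℤ g) =
      (LaurentPolynomial.T k * σ.polyT r) ⊗ₜ[ℂ]
        ∑ l ∈ Finset.range σ.order, ζ ^ (l * k) • σ.toLieEquiv^[l] x := by
  rw [elt, coe_tr, TensorProduct.tmul_sum]
  refine Finset.sum_congr rfl fun l _ => ?_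
  rw [twist_pow_tmul, TensorProduct.tmul_smul]

lemma elt_add_right (k : ℤ) (r : Polynomial ℂ) (x y : g) :
    σ.elt hζ k r (x + y) = σ.elt hζ k r x + σ.elt hζ k r y := by
  rw [elt, TensorProduct.tmul_add, map_add]; rfl

lemma elt_smul_right (k : ℤ) (r : Polynomial ℂ) (c : ℂ) (x : g) :
    σ.elt hζ k r (c • x) = c • σ.elt hζ k r x := by
  rw [elt, TensorProduct.tmul_smul, map_smul]; rfl

lemma elt_zero_right (k : ℤ) (r : Polynomial ℂ) : σ.elt hζ k r 0 = 0 := by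
  rw [elt, TensorProduct.tmul_zero, map_zero]

lemma elt_add_left (k : ℤ) (r r' : Polynomial ℂ) (x : g) :
    σ.elt hζ k (r + r') x = σ.elt hζ k r x + σ.elt hζ k r' x := by
  rw [elt, polyT, map_add, mul_add, TensorProduct.add_tmul, map_add]; rfl

lemma elt_smul_left (k : ℤ) (r : Polynomial ℂ) (c : ℂ) (x : g) :
    σ.elt hζ k (c • r) x = c • σ.elt hζ k r x := by
  rw [elt, polyT, map_smul, mul_smul_comm, ← TensorProduct.smul_tmul', map_smul]; rfl

lemma elt_X_pow_mul (k : ℤ) (n : ℕ) (r : Polynomial ℂ) (x : g) :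
    σ.elt hζ k (Polynomial.X ^ n * r) x = σ.elt hζ (k + σ.order * n) r x := by
  rw [elt, elt, polyT, map_mul, map_pow, Polynomial.aeval_X, LaurentPolynomial.T_pow, ← mul_assoc,
    ← LaurentPolynomial.T_add, mul_comm (n : ℤ)]

/-- Averaging forgets a prior application of σ̃. Consequently only one node from each orbit has to
be treated. -/
lemma elt_iterate (l : ℕ) (k : ℤ) (r : Polynomial ℂ) (x : g) :
    ζ ^ (l * k) • σ.elt hζ k r (σ.toLieEquiv^[l] x) = σ.elt hζ k r x := by
  induction l with
  | zero => simp
  | succ l ih =>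
    have h1 := σ.tr_twist hζ ((LaurentPolynomial.T k * σ.polyT r) ⊗ₜ[ℂ] σ.toLieEquiv^[l] x)
    have h2 := σ.twist_pow_tmul hζ 1 k r (σ.toLieEquiv^[l] x)
    rw [pow_one] at h2
    change σ.twist hζ _ = _ at h2
    rw [h2, map_smul] at h1
    rw [← ih, elt, elt, ← h1, smul_smul, ← zpow_add₀ (hζ.ne_zero σ.order_pos.ne'),
      ← Function.iterate_add_apply, add_comm 1 l]
    congr 2
    push_cast
    ring

lemma elt_iterate' (l : ℕ) (k : ℤ) (r : Polynomial ℂ) (x : g) :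
    σ.elt hζ k r (σ.toLieEquiv^[l] x) = (ζ ^ (-k)) ^ l • σ.elt hζ k r x := by
  rw [← σ.elt_iterate hζ l k r x, smul_smul, ← zpow_natCast, ← zpow_mul,
    ← zpow_add₀ (hζ.ne_zero σ.order_pos.ne')]
  ring_nf
  rw [zpow_zero, one_smul]

lemma lie_elt (k k' : ℤ) (r r' : Polynomial ℂ) (x y : g) :
    ⁅σ.elt hζ k r x, σ.elt hζ k' r' y⁆ = ∑ l ∈ Finset.range σ.order,
      ζ ^ (l * k') • σ.elt hζ (k + k') (r * r') ⁅x, σ.toLieEquiv^[l] y⁆ := by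
  rw [elt, lie_tr, coe_elt, LieAlgebra.ExtendScalars.bracket_tmul, lie_sum, TensorProduct.tmul_sum,
    map_sum]
  refine Finset.sum_congr rfl fun l _ => ?_
  rw [lie_smul, TensorProduct.tmul_smul, map_smul, elt, LaurentPolynomial.T_add, polyT, polyT,
    polyT, map_mul, mul_mul_mul_comm]

end DiagramAut

/-! ### Enveloping algebras: commutators and induction on words. -/

lemma envelopingAlgebra_ι_lie {L : Type*} [LieRing L] [LieAlgebra ℂ L] (x y : L) :
    UniversalEnvelopingAlgebra.ι ℂ ⁅x, y⁆ =
      UniversalEnvelopingAlgebra.ι ℂ x * UniversalEnvelopingAlgebra.ι ℂ y -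
        UniversalEnvelopingAlgebra.ι ℂ y * UniversalEnvelopingAlgebra.ι ℂ x := by
  let _ : LieRing (UniversalEnvelopingAlgebra ℂ L) := LieRing.ofAssociativeRing
  let _ : LieAlgebra ℂ (UniversalEnvelopingAlgebra ℂ L) := LieAlgebra.ofAssociativeAlgebra
  exact LieHom.map_lie (UniversalEnvelopingAlgebra.ι ℂ) x y

lemma envelopingAlgebra_induction {L : Type*} [LieRing L] [LieAlgebra ℂ L]
    {p : UniversalEnvelopingAlgebra ℂ L → Prop} (one : p 1)
    (smul : ∀ (c : ℂ) u, p u → p (c • u)) (add : ∀ u v, p u → p v → p (u + v))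
    (mul : ∀ (x : L) u, p u → p (UniversalEnvelopingAlgebra.ι ℂ x * u))
    (u : UniversalEnvelopingAlgebra ℂ L) : p u := by
  obtain ⟨a, rfl⟩ : ∃ a, UniversalEnvelopingAlgebra.mkAlgHom ℂ L a = u :=
    Quotient.exists_rep u
  -- Allowing an arbitrary right factor v makes the claim stable under products.
  suffices h : ∀ v, p v → p (UniversalEnvelopingAlgebra.mkAlgHom ℂ L a * v) by
    simpa using h 1 one
  induction a using TensorAlgebra.induction with
  | algebraMap r =>
    intro v hv
    rw [AlgHom.commutes, ← Algebra.smul_def]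
    exact smul r v hv
  | ι x => exact fun v hv => mul x v hv
  | mul a a' h h' => exact fun v hv => by rw [map_mul, mul_assoc]; exact h _ (h' _ hv)
  | add a a' h h' => exact fun v hv => by rw [map_add, add_mul]; exact add _ _ (h _ hv) (h' _ hv)

namespace DiagramAut

variable {b : LieAlgebra.Basis I H} (σ : DiagramAut b)
variable {ζ : ℂ} (hζ : IsPrimitiveRoot ζ σ.order)

/-! ### Annihilators of a vector in a module over the twisted loop algebra. -/

section Module

variable {V : Type*} [AddCommGroup V] [Module (σ.Env hζ) V]

/-- `L^σ(g)` acts on `V` through its enveloping algebra. -/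
abbrev act (y : σ.twistedLoop hζ) (w : V) : V := UniversalEnvelopingAlgebra.ι ℂ y • w

lemma act_add (x y : σ.twistedLoop hζ) (w : V) :
    σ.act hζ (x + y) w = σ.act hζ x w + σ.act hζ y w := by
  rw [act, map_add, add_smul]

lemma act_zero (w : V) : σ.act hζ 0 w = 0 := by
  rw [act, map_zero, zero_smul]

lemma act_sum {ι : Type*} (s : Finset ι) (F : ι → σ.twistedLoop hζ) (w : V) :
    σ.act hζ (∑ j ∈ s, F j) w = ∑ j ∈ s, σ.act hζ (F j) w := by
  rw [act, map_sum, Finset.sum_smul]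

lemma act_lie (x y : σ.twistedLoop hζ) (w : V) :
    σ.act hζ ⁅x, y⁆ w = σ.act hζ x (σ.act hζ y w) - σ.act hζ y (σ.act hζ x w) := by
  rw [act, envelopingAlgebra_ι_lie, sub_smul, mul_smul, mul_smul]

variable [Module ℂ V] [IsScalarTower ℂ (σ.Env hζ) V]

lemma act_smul (c : ℂ) (x : σ.twistedLoop hζ) (w : V) :
    σ.act hζ (c • x) w = c • σ.act hζ x w := by
  rw [act, map_smul, smul_assoc]

/-- Multiplying r by X^n only shifts k by mn, and the hypothesis covers every k. -/
lemma act_elt_mul (w : V) {r : Polynomial ℂ} {x : g}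
    (h : ∀ k, σ.act hζ (σ.elt hζ k r x) w = 0) (r' : Polynomial ℂ) (k : ℤ) :
    σ.act hζ (σ.elt hζ k (r * r') x) w = 0 := by
  induction r' using Polynomial.induction_on' with
  | add p q hp hq => rw [mul_add, elt_add_left, act_add, hp, hq, add_zero]
  | monomial n c =>
    rw [← mul_one c, ← smul_eq_mul c, ← Polynomial.smul_monomial, mul_smul_comm, elt_smul_left,
      act_smul, ← Polynomial.X_pow_eq_monomial, mul_comm, elt_X_pow_mul, h, smul_zero]

lemma sum_pow_eq_ite {ζ : ℂ} (hζ : IsPrimitiveRoot ζ σ.order) (l : ℕ) (hl : l < σ.order) :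
    ∑ a ∈ Finset.range σ.order, ζ ^ ((l : ℤ) * (a : ℕ)) = if l = 0 then (σ.order : ℂ) else 0 := by
  split_ifs with h0
  · simp [h0]
  · have h1 : ζ ^ l ≠ 1 := hζ.pow_ne_one_of_pos_of_lt h0 hl
    have h2 := mul_neg_geom_sum (ζ ^ l) σ.order
    rw [← pow_mul, mul_comm l, pow_mul, hζ.pow_eq_one, one_pow, sub_self] at h2
    rw [← (mul_eq_zero.1 h2).resolve_left (sub_ne_zero.2 h1.symm)]
    refine Finset.sum_congr rfl fun a _ => ?_
    rw [zpow_mul, zpow_natCast, zpow_natCast]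

/-- Fourier inversion on ℤ/m: by `lie_elt` each twisted bracket is a sum over all σ^l(y), and
summing over the splittings k = (k - a) + a isolates l = 0. Thus averages of untwisted brackets are
sums of twisted brackets. -/
lemma order_smul_elt_lie (k : ℤ) (r r' : Polynomial ℂ) (x y : g) :
    (σ.order : ℂ) • σ.elt hζ k (r * r') ⁅x, y⁆ =
      ∑ a ∈ Finset.range σ.order, ⁅σ.elt hζ (k - (a : ℕ)) r x, σ.elt hζ (a : ℕ) r' y⁆ := by
  simp only [lie_elt, sub_add_cancel]
  rw [Finset.sum_comm]
  simp only [← Finset.sum_smul]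
  rw [Finset.sum_eq_single_of_mem 0 (Finset.mem_range.2 σ.order_pos)]
  · simp
  · intro l hl h0
    rw [σ.sum_pow_eq_ite hζ l (Finset.mem_range.1 hl), if_neg h0, zero_smul]

lemma act_elt_lie (w : V) {r r' : Polynomial ℂ} {x y : g}
    (hx : ∀ k, σ.act hζ (σ.elt hζ k r x) w = 0) (hy : ∀ k, σ.act hζ (σ.elt hζ k r' y) w = 0)
    (k : ℤ) : σ.act hζ (σ.elt hζ k (r * r') ⁅x, y⁆) w = 0 := by
  have h1 : (σ.order : ℂ) ≠ 0 := by exact_mod_cast σ.order_pos.ne'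
  refine (smul_eq_zero_iff_right h1).1 ?_
  rw [← act_smul, order_smul_elt_lie, act_sum]
  refine Finset.sum_eq_zero fun a _ => ?_
  rw [act_lie, hx, hy]
  simp

/-- The elements `x` of `g` such that all `∑_l σ̃^l (t^k Q(t^m)^N ⊗ x)` kill `w` for
some `N` form a subalgebra. -/
def annSub (Q : Polynomial ℂ) (w : V) : LieSubalgebra ℂ g where
  carrier := {x | ∃ N : ℕ, ∀ k, σ.act hζ (σ.elt hζ k (Q ^ N) x) w = 0}
  add_mem' := by
    rintro x y ⟨N, hN⟩ ⟨N', hN'⟩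
    refine ⟨N + N', fun k => ?_⟩
    rw [elt_add_right, act_add, pow_add, σ.act_elt_mul hζ w hN, mul_comm,
      σ.act_elt_mul hζ w hN', add_zero]
  zero_mem' := ⟨0, fun k => by rw [elt_zero_right, act_zero]⟩
  smul_mem' := by
    rintro c x ⟨N, hN⟩
    exact ⟨N, fun k => by rw [elt_smul_right, act_smul, hN, smul_zero]⟩
  lie_mem' := by
    rintro x y ⟨N, hN⟩ ⟨N', hN'⟩
    exact ⟨N + N', fun k => by rw [pow_add]; exact σ.act_elt_lie hζ w hN hN' k⟩

lemma exists_forall_act_elt_eq_zero [FiniteDimensional ℂ g] (Q : Polynomial ℂ) (w : V)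
    (he : ∀ i, b.e i ∈ σ.annSub hζ Q w) (hf : ∀ i, b.f i ∈ σ.annSub hζ Q w) :
    ∃ N : ℕ, ∀ x k, σ.act hζ (σ.elt hζ k (Q ^ N) x) w = 0 := by
  have htop : σ.annSub hζ Q w = ⊤ := by
    rw [eq_top_iff, ← b.span_ef, LieSubalgebra.lieSpan_le]
    rintro x (⟨i, rfl⟩ | ⟨i, rfl⟩)
    · exact he i
    · exact hf i
  have hall : ∀ x : g, ∃ N : ℕ, ∀ k, σ.act hζ (σ.elt hζ k (Q ^ N) x) w = 0 := fun x => by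
    have : x ∈ σ.annSub hζ Q w := by rw [htop]; trivial
    exact this
  choose N hN using hall
  let B := Module.finBasis ℂ g
  -- The sum bounds every individual exponent of the basis, and larger exponents are harmless by
  -- `act_elt_mul`.
  refine ⟨∑ j, N (B j), fun x k => ?_⟩
  have hx : x ∈ Submodule.span ℂ (Set.range B) := by rw [B.span_eq]; trivial
  induction hx using Submodule.span_induction with
  | mem x hx =>
    obtain ⟨j, rfl⟩ := hx
    have hle : N (B j) ≤ ∑ j, N (B j) :=
      Finset.single_le_sum (f := fun j => N (B j)) (fun _ _ => Nat.zero_le _) (Finset.mem_univ j)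
    rw [← Nat.add_sub_cancel' hle, pow_add]
    exact σ.act_elt_mul hζ w (hN (B j)) _ _
  | zero => rw [elt_zero_right, act_zero]
  | add x y _ _ hx hy => rw [elt_add_right, act_add, hx, hy, add_zero]
  | smul c x _ hx => rw [elt_smul_right, act_smul, hx, smul_zero]

/-- The ideal `∑_l σ̃^l (Q(t^m) L(g))` kills the module generated by `w` if it kills `w`. -/
lemma act_tr_smul_eq_zero (r : Polynomial ℂ) (w : V)
    (h : ∀ x k, σ.act hζ (σ.elt hζ k r x) w = 0) (u : σ.Env hζ)
    (z : LieAlgebra.loopAlgebra ℂ ℤ g) : σ.act hζ (σ.tr hζ (σ.polyT r • z)) (u • w) = 0 := by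
  induction u using envelopingAlgebra_induction generalizing z with
  | one =>
    rw [one_smul]
    induction z using loop_induction with
    | T k x =>
      rw [TensorProduct.smul_tmul', smul_eq_mul, mul_comm]
      exact h x k
    | zero => rw [smul_zero, map_zero, act_zero]
    | add x y hx hy => rw [smul_add, map_add, act_add, hx, hy, add_zero]
  | smul c u hu =>
    rw [smul_assoc, act, ← smul_comm c]
    exact (congrArg (c • ·) (hu z)).trans (smul_zero c)
  | add u v hu hv =>
    rw [add_smul, act, smul_add]
    exact (congrArg₂ (· + ·) (hu z) (hv z)).trans (add_zero 0)
  | mul x u hu =>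
    -- With y in the ideal, y x u w = [y, x] u w + x y u w, and [y, x] is again the average of a
    -- multiple of r(t^m). This is why z is generalized in the induction.
    have h1 := σ.act_lie hζ (σ.tr hζ (σ.polyT r • z)) x (u • w)
    have h2 : ⁅σ.polyT r • z, (x : LieAlgebra.loopAlgebra ℂ ℤ g)⁆ =
        σ.polyT r • ⁅z, (x : LieAlgebra.loopAlgebra ℂ ℤ g)⁆ :=
      smul_lie (R := ℂ[T;T⁻¹]) (L := ℂ[T;T⁻¹] ⊗[ℂ] g) (M := ℂ[T;T⁻¹] ⊗[ℂ] g) (σ.polyT r) z _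
    have h3 : σ.act hζ x (0 : V) = 0 := smul_zero _
    rw [lie_tr, h2, hu, hu, h3, sub_zero] at h1
    rw [mul_smul]
    exact h1.symm

lemma iterate_mem_annSub (Q : Polynomial ℂ) (w : V) {x : g} (hx : x ∈ σ.annSub hζ Q w) (l : ℕ) :
    σ.toLieEquiv^[l] x ∈ σ.annSub hζ Q w := by
  obtain ⟨N, hN⟩ := hx
  exact ⟨N, fun k => by rw [elt_iterate', act_smul, hN, smul_zero]⟩

end Module

/-! ### The space `annSpace` -/

lemma exists_T_of_mem_closure (n : ℤ) {f : ℂ[T;T⁻¹]}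
    (hf : f ∈ Submonoid.closure
      {(LaurentPolynomial.T n : ℂ[T;T⁻¹]), LaurentPolynomial.T (-n)}) :
    ∃ k : ℤ, f = LaurentPolynomial.T (n * k) := by
  induction hf using Submonoid.closure_induction with
  | mem f hf =>
    rcases hf with rfl | rfl
    · exact ⟨1, by rw [mul_one]⟩
    · exact ⟨-1, by rw [mul_neg_one]⟩
  | one => exact ⟨0, by rw [mul_zero, LaurentPolynomial.T_zero]⟩
  | mul f f' _ _ hf hf' =>
    obtain ⟨k, rfl⟩ := hf
    obtain ⟨k', rfl⟩ := hf'
    exact ⟨k + k', by rw [mul_add, LaurentPolynomial.T_add]⟩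

/-- An element of g_ε ⊗ t^{m-ε} ℂ[t^m, t^{-m}] is fixed by σ̃, so it is 1/m times its own average;
the factor r is then pulled out of the product. -/
lemma annSpace_le_range {l : ℕ} (a : Fin l → ℂˣ) (N : ℕ) (r : Polynomial ℂ)
    (hr : r ∣ ∏ j, (Polynomial.X - Polynomial.C ((a j : ℂ) ^ σ.order)) ^ N)
    {y : LieAlgebra.loopAlgebra ℂ ℤ g} (hy : y ∈ σ.annSpace ζ a N) :
    ∃ z, y = σ.tr hζ (σ.polyT r • z) := by
  let Φ : LieAlgebra.loopAlgebra ℂ ℤ g →ₗ[ℂ] LieAlgebra.loopAlgebra ℂ ℤ g :=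
    { toFun := fun z => σ.tr hζ (σ.polyT r • z)
      map_add' := fun x y => by rw [smul_add, map_add]; rfl
      map_smul' := fun c x => by rw [smul_comm, map_smul]; rfl }
  suffices h : σ.annSpace ζ a N ≤ LinearMap.range Φ by
    obtain ⟨z, hz⟩ := h hy
    exact ⟨z, hz.symm⟩
  refine iSup_le fun ε => Submodule.span_le.2 ?_
  rintro _ ⟨x, hx, f, hf, rfl⟩
  obtain ⟨q, hq⟩ := hr
  have hprod : ∏ j, (LaurentPolynomial.T (σ.order : ℤ) -
      LaurentPolynomial.C ((a j : ℂ) ^ σ.order)) ^ N = σ.polyT (r * q) := by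
    rw [← hq, polyT, map_prod]
    refine Finset.prod_congr rfl fun j _ => ?_
    simp only [map_pow, map_sub, Polynomial.aeval_X, Polynomial.aeval_C]
    rfl
  rw [hprod]
  have hf' : f ∈ Submodule.span ℂ (Submonoid.closure {(LaurentPolynomial.T (σ.order : ℤ) :
      ℂ[T;T⁻¹]), LaurentPolynomial.T (-(σ.order : ℤ))} : Set ℂ[T;T⁻¹]) := by
    rw [← Algebra.adjoin_eq_span]; exact hf
  clear hf
  rw [SetLike.mem_coe]
  induction hf' using Submodule.span_induction with
  | zero => rw [mul_zero, TensorProduct.zero_tmul]; exact zero_mem _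
  | add f f' _ _ hf hf' => rw [mul_add, TensorProduct.add_tmul]; exact add_mem hf hf'
  | smul c f _ hf =>
    rw [mul_smul_comm, ← TensorProduct.smul_tmul']; exact Submodule.smul_mem _ c hf
  | mem f hf =>
    obtain ⟨k, rfl⟩ := exists_T_of_mem_closure _ hf
    have h0 : ζ ≠ 0 := hζ.ne_zero σ.order_pos.ne'
    have h1 : (σ.order : ℂ) ≠ 0 := by exact_mod_cast σ.order_pos.ne'
    have hit : ∀ l : ℕ, σ.toLieEquiv^[l] x = ζ ^ ((l : ℤ) * (ε : ℕ)) • x := by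
      intro l
      induction l with
      | zero => simp
      | succ l ih =>
        rw [Function.iterate_succ_apply', ih, map_smul, (σ.mem_eigen ζ).1 hx, smul_smul,
          ← zpow_add₀ h0]
        congr 2
        push_cast
        ring
    have hz : ((LaurentPolynomial.T ((σ.order : ℤ) - (ε : ℕ)) * σ.polyT (r * q) *
        LaurentPolynomial.T (σ.order * k)) ⊗ₜ[ℂ] x : LieAlgebra.loopAlgebra ℂ ℤ g) =
        ((σ.order : ℂ)⁻¹ • σ.elt hζ (σ.order - (ε : ℕ) + σ.order * k) (r * q) x :
          σ.twistedLoop hζ) := by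
      have hs : ∀ l ∈ Finset.range σ.order, ζ ^ ((l : ℤ) * (σ.order - (ε : ℕ) + σ.order * k)) •
          σ.toLieEquiv^[l] x = x := by
        intro l _
        rw [hit, smul_smul, ← zpow_add₀ h0]
        have : (l : ℤ) * (σ.order - (ε : ℕ) + σ.order * k) + l * (ε : ℕ) =
          σ.order * (l * (1 + k)) := by ring
        rw [this, zpow_mul, zpow_natCast, hζ.pow_eq_one, one_zpow, one_smul]
      change _ = (σ.order : ℂ)⁻¹ • (σ.elt hζ _ _ x : LieAlgebra.loopAlgebra ℂ ℤ g)
      rw [coe_elt, Finset.sum_congr rfl hs, Finset.sum_const,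
        Finset.card_range, ← Nat.cast_smul_eq_nsmul ℂ, TensorProduct.tmul_smul, smul_smul,
        inv_mul_cancel₀ h1, one_smul, LaurentPolynomial.T_add]
      congr 1
      ring
    rw [hz]
    refine ⟨(σ.order : ℂ)⁻¹ • ((LaurentPolynomial.T (σ.order - (ε : ℕ) + σ.order * k) *
      σ.polyT q) ⊗ₜ[ℂ] x), ?_⟩
    rw [map_smul]
    refine congrArg (fun y : σ.twistedLoop hζ =>
      (σ.order : ℂ)⁻¹ • (y : LieAlgebra.loopAlgebra ℂ ℤ g)) ?_
    rw [TensorProduct.smul_tmul', elt, smul_eq_mul, polyT, polyT, polyT, map_mul]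
    congr 2
    ring

end DiagramAut

/-! ### Averaged Chevalley generators, and the step from h_i to f_i. -/

namespace DiagramAut

variable {b : LieAlgebra.Basis I H} (σ : DiagramAut b)
variable {ζ : ℂ} (hζ : IsPrimitiveRoot ζ σ.order)

/-- In degree k = 0 both elements are Laurent polynomials times the same vector, the sum of the
σ^l(x). -/
lemma lie_elt_same (r r' : Polynomial ℂ) (x : g) :
    ⁅σ.elt hζ 0 r x, σ.elt hζ 0 r' x⁆ = 0 := by
  apply Subtype.ext
  rw [LieSubalgebra.coe_bracket, coe_elt, coe_elt, LieAlgebra.ExtendScalars.bracket_tmul, lie_self,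
    TensorProduct.tmul_zero]
  rfl

lemma lie_elt_h_f (i : I) (k : ℤ) (r r' : Polynomial ℂ) :
    ⁅σ.elt hζ k r (b.h i), σ.elt hζ 0 r' (b.f i)⁆ =
      (-∑ l ∈ Finset.range σ.order, (b.A ((σ.perm ^ l) i) i : ℂ) * (ζ ^ (-k)) ^ l) •
        σ.elt hζ k (r * r') (b.f i) := by
  rw [lie_elt, ← Finset.sum_neg_distrib, Finset.sum_smul]
  refine Finset.sum_congr rfl fun l _ => ?_
  rw [σ.iterate_apply_of_perm b.f σ.map_f, mul_zero, zpow_zero, one_smul, add_zero, b.lie_h_f,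
    ← Int.cast_smul_eq_zsmul ℂ, elt_smul_right, ← σ.iterate_apply_of_perm b.f σ.map_f,
    elt_iterate', smul_smul]
  push_cast
  rw [neg_mul]

lemma coe_elt_one (k : ℤ) (y : I → g) (hy : ∀ i, σ.toLieEquiv (y i) = y (σ.perm i)) (i : I) :
    (σ.elt hζ k 1 (y i) : LieAlgebra.loopAlgebra ℂ ℤ g) =
      (LaurentPolynomial.T k : ℂ[T;T⁻¹]) ⊗ₜ[ℂ] σ.orbitSum ζ y i (-k) := by
  rw [coe_elt, polyT, map_one, mul_one, orbitSum]
  congr 1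
  refine Finset.sum_congr rfl fun l _ => ?_
  rw [σ.iterate_apply_of_perm y hy, mul_neg, neg_neg]

variable [DecidableEq I]

/-- As [e_i, f_j] = 0 for j ≠ i, only the l with σ^l(i) = i contribute. -/
lemma lie_elt_e_f (i : I) (r r' : Polynomial ℂ) :
    ⁅σ.elt hζ 0 r (b.e i), σ.elt hζ 0 r' (b.f i)⁆ =
      (((Finset.range σ.order).filter fun l => (σ.perm ^ l) i = i).card : ℂ) •
        σ.elt hζ 0 (r * r') (b.h i) := by
  rw [lie_elt, Finset.card_filter, Nat.cast_sum, Finset.sum_smul]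
  refine Finset.sum_congr rfl fun l _ => ?_
  rw [σ.iterate_apply_of_perm b.f σ.map_f, mul_zero, zpow_zero, one_smul, add_zero]
  by_cases h : (σ.perm ^ l) i = i
  · rw [if_pos h, h, (b.sl2 i).lie_e_f, Nat.cast_one, one_smul]
  · rw [if_neg h, b.lie_e_f_ne _ _ (Ne.symm h), elt_zero_right, Nat.cast_zero, zero_smul]

section Module

variable [FiniteDimensional ℂ g] [LieAlgebra.IsSimple ℂ g]
variable {V : Type*} [AddCommGroup V] [Module (σ.Env hζ) V] [Module ℂ V]
  [IsScalarTower ℂ (σ.Env hζ) V]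

/-- If a power of `x_i^- ⊗ 1` kills `w`, then a power of `Q` annihilates `w` on the
root vectors for `-α_i`, for `Q` with `h_i ⊗ Q(t^m) r(t^m)` killing `w`. -/
lemma f_mem_annSub (hb : b.A.IsSimplyLaced) (i : I) (Q : Polynomial ℂ) (w : V)
    (he : ∀ k r, σ.act hζ (σ.elt hζ k r (b.e i)) w = 0)
    (hh : ∀ k, ∃ c : ℂ, σ.act hζ (σ.elt hζ k 1 (b.h i)) w = c • w)
    (hQ : ∀ r, σ.act hζ (σ.elt hζ 0 (Q * r) (b.h i)) w = 0) (n : ℕ)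
    (hn : UniversalEnvelopingAlgebra.ι ℂ (σ.elt hζ 0 1 (b.f i)) ^ (n + 1) • w = 0) :
    b.f i ∈ σ.annSub hζ Q w := by
  have h1 : UniversalEnvelopingAlgebra.ι ℂ (σ.elt hζ 0 (Q ^ n) (b.f i)) • w = 0 := by
    refine smul_eq_zero_of_pow_smul_eq_zero
      (UniversalEnvelopingAlgebra.ι ℂ (σ.elt hζ 0 Q (b.e i)))
      (fun j => UniversalEnvelopingAlgebra.ι ℂ (σ.elt hζ 0 (Q ^ j) (b.f i)))
      (fun j => UniversalEnvelopingAlgebra.ι ℂ (σ.elt hζ 0 (Q ^ j) (b.h i)))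
      (((Finset.range σ.order).filter fun l => (σ.perm ^ l) i = i).card : ℂ)
      (-∑ l ∈ Finset.range σ.order, (b.A ((σ.perm ^ l) i) i : ℂ) * (ζ ^ (-(0 : ℤ))) ^ l)
      ?_ ?_ (fun j => ?_) (fun a j => ?_) (fun a j => ?_) w (he 0 Q) (fun j => ?_) n ?_
    · rw [Nat.cast_ne_zero, Finset.card_ne_zero]
      exact ⟨0, by simp [σ.order_pos]⟩
    · refine neg_ne_zero.2 (σ.sum_A_mul_pow_ne_zero hb i _ ?_ ?_) <;> simp
    · rw [← map_smul, pow_succ', ← lie_elt_e_f, envelopingAlgebra_ι_lie]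
      abel
    · rw [← map_smul, pow_add, ← lie_elt_h_f, envelopingAlgebra_ι_lie]
      abel
    · have := envelopingAlgebra_ι_lie (σ.elt hζ 0 (Q ^ a) (b.f i)) (σ.elt hζ 0 (Q ^ j) (b.f i))
      rw [lie_elt_same, map_zero] at this
      exact (sub_eq_zero.1 this.symm)
    · rw [pow_succ']
      exact hQ _
    · rw [pow_zero]
      exact hn
  refine ⟨n, fun k => ?_⟩
  -- The case k = 0 is h1. Bracketing with h_i ⊗ t^k, for which w is an eigenvector, reaches degree
  -- k up to a scalar.
  obtain ⟨c, hc⟩ := hh k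
  have h2 := σ.act_lie hζ (σ.elt hζ k 1 (b.h i)) (σ.elt hζ 0 (Q ^ n) (b.f i)) w
  have h3 : σ.act hζ (σ.elt hζ 0 (Q ^ n) (b.f i)) w = 0 := h1
  rw [h3, hc, lie_elt_h_f, one_mul, act_smul, act, act, act, smul_zero,
    smul_comm _ c, h1, smul_zero, sub_zero] at h2
  by_cases hst : ∀ l, (σ.perm ^ l) i = i → (ζ ^ (-k)) ^ l = 1
  · refine (smul_eq_zero_iff_right (neg_ne_zero.2 (σ.sum_A_mul_pow_ne_zero hb i _ ?_ hst))).1 h2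
    rw [norm_zpow, hζ.norm'_eq_one σ.order_pos.ne', one_zpow]
  -- The scalar may vanish when some σ^l fixes i but ζ^{-kl} ≠ 1; in that case the averaged element
  -- itself is zero by `elt_iterate'`.
  · push Not at hst
    obtain ⟨l, hl, hne⟩ := hst
    have h4 := σ.elt_iterate' hζ l k (Q ^ n) (b.f i)
    rw [σ.iterate_apply_of_perm b.f σ.map_f, hl, eq_comm, ← sub_eq_zero] at h4
    nth_rewrite 2 [← one_smul ℂ (σ.elt hζ k (Q ^ n) (b.f i))] at h4
    rw [← sub_smul, smul_eq_zero_iff_right (sub_ne_zero.2 hne)] at h4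
    rw [h4, act_zero]

end Module

/-! ### The elements `h_{i,ε} ⊗ t^k` -/

/-- The average of a fixed vector is a geometric sum over the m-th roots of unity: m or 0 according
to whether m divides k, as in the definition of `hEps`. -/
lemma elt_h_of_fixed {i : I} (hi : σ.perm i = i) (k : ℤ) :
    σ.elt hζ k 1 (b.h i) = (σ.order : ℂ) • σ.hLoop hζ i k := by
  apply Subtype.ext
  rw [coe_elt_one _ _ _ _ σ.map_h]
  change _ = (σ.order : ℂ) • ((LaurentPolynomial.T k : ℂ[T;T⁻¹]) ⊗ₜ[ℂ] σ.hEps ζ i (-k))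
  rw [← TensorProduct.tmul_smul]
  congr 1
  have hpow : ∀ l : ℕ, (σ.perm ^ l) i = i := fun l => by
    induction l with
    | zero => rfl
    | succ l ih => rw [pow_succ', Equiv.Perm.mul_apply, ih, hi]
  simp only [orbitSum, hEps, hi, if_true, hpow, ← Finset.sum_smul, mul_neg, neg_neg]
  have h0 : ζ ≠ 0 := hζ.ne_zero σ.order_pos.ne'
  by_cases hk : (σ.order : ℤ) ∣ -k
  · rw [if_pos hk]
    have : ∀ l ∈ Finset.range σ.order, ζ ^ ((l : ℤ) * k) = 1 := by
      intro l _
      obtain ⟨c, hc⟩ := (dvd_neg.1 hk).mul_left (l : ℤ)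
      rw [hc, zpow_mul, zpow_natCast, hζ.pow_eq_one, one_zpow]
    rw [Finset.sum_congr rfl this]
    simp
  · rw [if_neg hk, smul_zero]
    have h1 : ζ ^ k ≠ 1 := fun h => hk (dvd_neg.2 ((hζ.zpow_eq_one_iff_dvd k).1 h))
    have h2 := mul_neg_geom_sum (ζ ^ k) σ.order
    rw [← zpow_natCast, ← zpow_mul, mul_comm k, zpow_mul, zpow_natCast, hζ.pow_eq_one, one_zpow,
      sub_self] at h2
    have h3 := (mul_eq_zero.1 h2).resolve_left (sub_ne_zero.2 h1.symm)
    simp only [← zpow_natCast, ← zpow_mul, mul_comm k] at h3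
    rw [h3, zero_smul]

lemma elt_h_of_middle {i : I} (hi : σ.perm i ≠ i) (hm : σ.IsMiddle i) (k : ℤ) :
    σ.hLoop hζ i k = (if (σ.order : ℤ) ∣ k then (2 : ℂ) else 1) • σ.elt hζ k 1 (b.h i) := by
  apply Subtype.ext
  change (LaurentPolynomial.T k : ℂ[T;T⁻¹]) ⊗ₜ[ℂ] σ.hEps ζ i (-k) =
    (if (σ.order : ℤ) ∣ k then (2 : ℂ) else 1) •
      (σ.elt hζ k 1 (b.h i) : LieAlgebra.loopAlgebra ℂ ℤ g)
  rw [coe_elt_one _ _ _ _ σ.map_h, hEps, if_neg hi, if_pos hm, TensorProduct.tmul_smul]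
  simp only [dvd_neg]

lemma elt_h_of_ne {i : I} (hi : σ.perm i ≠ i) (hm : ¬ σ.IsMiddle i) (k : ℤ) :
    σ.hLoop hζ i k = σ.elt hζ k 1 (b.h i) := by
  apply Subtype.ext
  rw [coe_elt_one _ _ _ _ σ.map_h]
  change (LaurentPolynomial.T k : ℂ[T;T⁻¹]) ⊗ₜ[ℂ] σ.hEps ζ i (-k) = _
  rw [hEps, if_neg hi, if_neg hm]

lemma xLoop_eq (i : I) : ∃ c : ℂ, c ≠ 0 ∧ σ.elt hζ 0 1 (b.f i) = c • σ.xLoop hζ i := by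
  have key : ∀ c : ℂ, σ.orbitSum ζ b.f i 0 = c • σ.xMinus ζ i →
      σ.elt hζ 0 1 (b.f i) = c • σ.xLoop hζ i := by
    intro c hc
    apply Subtype.ext
    rw [coe_elt_one _ _ _ _ σ.map_f]
    change _ = c • ((LaurentPolynomial.T 0 : ℂ[T;T⁻¹]) ⊗ₜ[ℂ] σ.xMinus ζ i)
    rw [← TensorProduct.tmul_smul, ← hc, neg_zero]
  by_cases hi : σ.perm i = i
  · refine ⟨σ.order, by exact_mod_cast σ.order_pos.ne', key _ ?_⟩
    have hpow : ∀ l : ℕ, (σ.perm ^ l) i = i := fun l => by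
      induction l with
      | zero => rfl
      | succ l ih => rw [pow_succ', Equiv.Perm.mul_apply, ih, hi]
    rw [xMinus, if_pos hi, orbitSum]
    simp [hpow, Nat.cast_smul_eq_nsmul]
  · by_cases hm : σ.IsMiddle i
    · have h2 : (Real.sqrt 2 : ℂ) ≠ 0 := by
        rw [Complex.ofReal_ne_zero]; positivity
      refine ⟨(Real.sqrt 2 : ℂ)⁻¹, inv_ne_zero h2, key _ ?_⟩
      rw [xMinus, if_neg hi, if_pos hm, smul_smul, inv_mul_cancel₀ h2, one_smul]
    · refine ⟨1, one_ne_zero, key _ ?_⟩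
      rw [xMinus, if_neg hi, if_neg hm, one_smul]

lemma hEps_mem_cartan (i : I) (k : ℤ) : σ.hEps ζ i k ∈ H := by
  have hh : ∀ j, b.h j ∈ H := fun j => (b.h' j).2
  have ho : σ.orbitSum ζ b.h i k ∈ H := sum_mem fun l _ => H.smul_mem _ (hh _)
  unfold hEps
  split_ifs
  · exact hh _
  · exact H.zero_mem
  · exact H.smul_mem _ ho
  · exact H.smul_mem _ ho
  · exact ho

lemma commute_hLoop (i : I) (k l : ℤ) :
    Commute (UniversalEnvelopingAlgebra.ι ℂ (σ.hLoop hζ i k))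
      (UniversalEnvelopingAlgebra.ι ℂ (σ.hLoop hζ i l)) := by
  have h0 : ⁅σ.hLoop hζ i k, σ.hLoop hζ i l⁆ = 0 := by
    apply Subtype.ext
    change ⁅(LaurentPolynomial.T k : ℂ[T;T⁻¹]) ⊗ₜ[ℂ] σ.hEps ζ i (-k),
      (LaurentPolynomial.T l : ℂ[T;T⁻¹]) ⊗ₜ[ℂ] σ.hEps ζ i (-l)⁆ = 0
    have := b.isLieAbelian_cartan
    have h1 := trivial_lie_zero H H ⟨_, σ.hEps_mem_cartan (ζ := ζ) i (-k)⟩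
      ⟨_, σ.hEps_mem_cartan (ζ := ζ) i (-l)⟩
    have h2 : ⁅σ.hEps ζ i (-k), σ.hEps ζ i (-l)⁆ = 0 := congrArg Subtype.val h1
    rw [LieAlgebra.ExtendScalars.bracket_tmul, h2, TensorProduct.tmul_zero]
  have := envelopingAlgebra_ι_lie (σ.hLoop hζ i k) (σ.hLoop hζ i l)
  rw [h0, map_zero] at this
  exact sub_eq_zero.1 this.symm

lemma coeff_logP (s : ℤˣ) (i : I) (n : ℕ) : ∃ (c : ℂ) (k : ℤ),
    PowerSeries.coeff n (σ.logP hζ s i) = c • UniversalEnvelopingAlgebra.ι ℂ (σ.hLoop hζ i k) := by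
  rw [logP, PowerSeries.coeff_mk]
  split_ifs
  · exact ⟨0, 0, (zero_smul _ _).symm⟩
  all_goals exact ⟨_, _, rfl⟩

lemma commute_coeff_logP (s : ℤˣ) (i : I) (n n' : ℕ) :
    Commute (PowerSeries.coeff n (σ.logP hζ s i)) (PowerSeries.coeff n' (σ.logP hζ s i)) := by
  obtain ⟨c, k, h⟩ := σ.coeff_logP hζ s i n
  obtain ⟨c', k', h'⟩ := σ.coeff_logP hζ s i n'
  rw [h, h']
  exact ((σ.commute_hLoop hζ i k k').smul_left c).smul_right c'

end DiagramAut

/-! ### Inverse roots of π and the resulting action of the h_i. -/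

namespace DiagramAut

variable {b : LieAlgebra.Basis I H} (σ : DiagramAut b)

/-- Linear extension from monomials: if t^{mk} acts as c times the k-th power sum, then r(t^m) acts
as c times the sum of the values of r on M. -/
lemma act_elt_eq_zero_of_forall_eval {ζ : ℂ} (hζ : IsPrimitiveRoot ζ σ.order) {V : Type*}
    [AddCommGroup V] [Module (σ.Env hζ) V] [Module ℂ V] [IsScalarTower ℂ (σ.Env hζ) V]
    (y : g) (M : Multiset ℂˣ) (w : V) (c : ℂ)
    (h : ∀ k : ℤ, σ.act hζ (σ.elt hζ (σ.order * k) 1 y) w = (c * powerSum M k) • w)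
    (r : Polynomial ℂ) (hr : ∀ a ∈ M, r.eval (a : ℂ) = 0) :
    σ.act hζ (σ.elt hζ 0 r y) w = 0 := by
  have key : ∀ r : Polynomial ℂ, σ.act hζ (σ.elt hζ 0 r y) w =
      (c * (M.map fun a : ℂˣ => r.eval (a : ℂ)).sum) • w := by
    intro r
    induction r using Polynomial.induction_on' with
    | add p q hp hq =>
      rw [elt_add_left, act_add, hp, hq, ← add_smul, ← mul_add, ← Multiset.sum_map_add]
      simp only [Polynomial.eval_add]
    | monomial n a =>
      have h1 := h n
      rw [← zero_add ((σ.order : ℤ) * n), ← elt_X_pow_mul, mul_one] at h1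
      rw [← mul_one a, ← smul_eq_mul, ← Polynomial.smul_monomial, ← Polynomial.X_pow_eq_monomial,
        elt_smul_left, act_smul, h1, smul_smul, powerSum]
      simp only [Polynomial.eval_smul, Polynomial.eval_pow, Polynomial.eval_X, smul_eq_mul,
        Multiset.sum_map_mul_left]
      congr 1
      simp
      ring
  rw [key, Multiset.map_congr rfl hr]
  simp

variable [DecidableEq I]

/-- The inverse root of the `i`-th entry of `π_{λ,a}^σ`. -/
def invRoot (i : I) (a : ℂˣ) : ℂˣ := if σ.perm i = i then a ^ σ.order else a

lemma piWeight_apply {I₀ : Finset I} (lam : I₀ → ℕ) (a : ℂˣ) (i : I₀) :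
    σ.piWeight I₀ lam a i = (1 - Polynomial.C (σ.invRoot i a : ℂ) * Polynomial.X) ^
      (if σ.IsMiddle i then lam i / 2 else lam i) := by
  have h : ((σ.invRoot i a : ℂˣ) : ℂ) = if σ.perm i = i then (a : ℂ) ^ σ.order else (a : ℂ) := by
    unfold invRoot; split_ifs <;> simp
  rw [piWeight, Finset.prod_apply, Finset.prod_eq_single i]
  · rw [Pi.pow_apply, piGen, Pi.mulSingle_eq_same, h]
  · intro j _ hj
    rw [Pi.pow_apply, piGen, Pi.mulSingle_eq_of_ne hj.symm, one_pow]
  · exact fun hi => absurd (Finset.mem_univ _) hi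

lemma exists_eq_ofInvRoots {I₀ : Finset I} {p : I₀ → Polynomial ℂ} (hp : p ∈ σ.monoidP I₀)
    (i : I₀) : ∃ M, p i = ofInvRoots M := by
  induction hp using Submonoid.closure_induction with
  | mem p hp =>
    obtain ⟨lam, _, a, rfl⟩ := hp
    exact ⟨Multiset.replicate (if σ.IsMiddle i then lam i / 2 else lam i) (σ.invRoot i a), by
      rw [piWeight_apply, ofInvRoots, Multiset.map_replicate, Multiset.prod_replicate]⟩
  | one => exact ⟨0, by simp [ofInvRoots]⟩
  | mul p q _ _ hp hq =>
    obtain ⟨M, hM⟩ := hp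
    obtain ⟨M', hM'⟩ := hq
    exact ⟨M + M', by rw [ofInvRoots_add, Pi.mul_apply, hM, hM']⟩

/-- c⁻¹ is a root of the i-th entry, hence of one of its linear factors, whatever factorization is
given. -/
lemma exists_eq_invRoot {I₀ : Finset I} {l : ℕ} (lam : Fin l → I₀ → ℕ) (a : Fin l → ℂˣ) (i : I₀)
    {M : Multiset ℂˣ} (hM : (∏ r, σ.piWeight I₀ (lam r) (a r)) i = ofInvRoots M) {c : ℂˣ}
    (hc : c ∈ M) : ∃ r, c = σ.invRoot i (a r) := by
  have h1 : (ofInvRoots M).eval (c : ℂ)⁻¹ = 0 := by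
    obtain ⟨M', rfl⟩ := Multiset.exists_cons_of_mem hc
    rw [ofInvRoots_cons, Polynomial.eval_mul]
    simp
  rw [← hM, Finset.prod_apply, Polynomial.eval_prod, Finset.prod_eq_zero_iff] at h1
  obtain ⟨r, _, hr⟩ := h1
  refine ⟨r, ?_⟩
  rw [piWeight_apply, Polynomial.eval_pow] at hr
  have h2 := eq_zero_of_pow_eq_zero hr
  simp only [Polynomial.eval_sub, Polynomial.eval_one, Polynomial.eval_mul, Polynomial.eval_C,
    Polynomial.eval_X] at h2
  apply Units.ext
  have h3 := sub_eq_zero.1 h2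
  field_simp at h3
  exact h3

variable {ζ : ℂ} (hζ : IsPrimitiveRoot ζ σ.order)

section Module

variable {V : Type*} [AddCommGroup V] [Module (σ.Env hζ) V] [Module ℂ V]
  [IsScalarTower ℂ (σ.Env hζ) V]

/-- The coefficients of `log P_{i,σ}^±` act on `w` through the power sums of the inverse roots. -/
lemma coeff_logP_smul (i : I) (M : Multiset ℂˣ) (w : V)
    (h : ∀ s n, PowerSeries.coeff n (σ.P hζ s i) • w = (signPoly s (ofInvRoots M)).coeff n • w)
    (s : ℤˣ) (n : ℕ) (hn : n ≠ 0) :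
    PowerSeries.coeff n (σ.logP hζ s i) • w = (-(powerSum M (s * n)) / n) • w := by
  rw [← powerSum_map_zpow]
  refine coeff_smul_of_psExp _ ?_ (σ.commute_coeff_logP hζ s i) _ w (fun n => ?_) n hn
  · rw [← PowerSeries.coeff_zero_eq_constantCoeff_apply, logP, PowerSeries.coeff_mk, if_pos rfl]
  · rw [← signPoly_ofInvRoots]
    exact h s n

/-- The action of the `h_i ⊗ t^k` on `w`. -/
lemma act_elt_h [FiniteDimensional ℂ g] [LieAlgebra.IsSimple ℂ g] (hb : b.A.IsSimplyLaced)
    (i : I) (M : Multiset ℂˣ) (w : V)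
    (h0 : σ.act hζ (σ.hLoop hζ i 0) w =
      (if σ.IsMiddle i then 2 * (M.card : ℂ) else M.card) • w)
    (h : ∀ s n, PowerSeries.coeff n (σ.P hζ s i) • w =
      (signPoly s (ofInvRoots M)).coeff n • w) :
    (∀ k, ∃ c : ℂ, σ.act hζ (σ.elt hζ k 1 (b.h i)) w = c • w) ∧
    ∃ c : ℂ, ∀ k : ℤ, σ.act hζ (σ.elt hζ (σ.order * k) 1 (b.h i)) w =
      (c * powerSum (if σ.perm i = i then M else M.map (· ^ σ.order)) k) • w := by
  have hlog := σ.coeff_logP_smul hζ i M w h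
  -- Positive k is read off from P^+, negative k from P^-, and k = 0 from the weight relation.
  have hsgn : ∀ k : ℤ, k ≠ 0 → ∃ (s : ℤˣ) (n : ℕ), n ≠ 0 ∧ k = s * n := by
    intro k hk
    rcases Int.natAbs_eq k with h | h
    · exact ⟨1, k.natAbs, Int.natAbs_ne_zero.2 hk, by simpa using h⟩
    · exact ⟨-1, k.natAbs, Int.natAbs_ne_zero.2 hk, by simpa using h⟩
  have hm0 : (σ.order : ℂ) ≠ 0 := by exact_mod_cast σ.order_pos.ne'
  have hp0 : powerSum M 0 = M.card := by simp [powerSum]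
  have hmap : ∀ k : ℤ, powerSum (M.map (· ^ σ.order)) k = powerSum M (σ.order * k) := fun k => by
    simpa using powerSum_map_zpow M σ.order k
  by_cases hi : σ.perm i = i
  · have hnm : ¬ σ.IsMiddle i := fun hm => by
      have h3 : IsAddTorsionFree g := .of_isTorsionFree ℂ g
      rw [IsMiddle, hi, b.A_diag_eq_two] at hm
      omega
    have key : ∀ k : ℤ, σ.act hζ (σ.hLoop hζ i (σ.order * k)) w = powerSum M k • w := by
      intro k
      rcases eq_or_ne k 0 with rfl | hk
      · rw [mul_zero, h0, if_neg hnm, hp0]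
      · obtain ⟨s, n, hn, rfl⟩ := hsgn k hk
        have hn' : (n : ℂ) ≠ 0 := by exact_mod_cast hn
        have h1 := hlog s n hn
        rw [logP, PowerSeries.coeff_mk, if_neg hn, if_pos hi, smul_assoc] at h1
        have h2 := congrArg (fun v => (-(n : ℂ)) • v) h1
        simp only [smul_smul] at h2
        rw [show -(n : ℂ) * -(1 / n) = 1 by field_simp, one_smul,
          show -(n : ℂ) * (-powerSum M (s * n) / n) = powerSum M (s * n) by field_simp] at h2
        rw [← h2, ← mul_assoc, mul_comm (σ.order : ℤ), mul_assoc]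
    refine ⟨fun k => ?_, σ.order, fun k => ?_⟩
    · rw [σ.elt_h_of_fixed hζ hi]
      by_cases hk : (σ.order : ℤ) ∣ k
      · obtain ⟨k, rfl⟩ := hk
        exact ⟨_, by rw [act_smul, key, smul_smul]⟩
      · refine ⟨0, ?_⟩
        have : σ.hLoop hζ i k = 0 := by
          apply Subtype.ext
          change (LaurentPolynomial.T k : ℂ[T;T⁻¹]) ⊗ₜ[ℂ] σ.hEps ζ i (-k) = 0
          rw [hEps, if_pos hi, if_neg (by rwa [dvd_neg]), TensorProduct.tmul_zero]
        rw [this, smul_zero, act_zero, zero_smul]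
    · rw [σ.elt_h_of_fixed hζ hi, act_smul, key, smul_smul, if_pos hi]
  by_cases hm : σ.IsMiddle i
  -- In the degrees mk, even because m is, the factor 2 in the action of `hLoop` cancels the 1/2
  -- relating it to `elt`.
  · have hev := σ.even_order_of_isMiddle hb hm
    have key : ∀ k : ℤ, σ.act hζ (σ.hLoop hζ i k) w =
        ((if Even k then 2 else -1) * powerSum M k) • w := by
      intro k
      rcases eq_or_ne k 0 with rfl | hk
      · rw [h0, if_pos hm, hp0, if_pos Even.zero]
      · obtain ⟨s, n, hn, rfl⟩ := hsgn k hk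
        have hn' : (n : ℂ) ≠ 0 := by exact_mod_cast hn
        have h1 := hlog s n hn
        rw [logP, PowerSeries.coeff_mk, if_neg hn, if_neg hi, if_pos hm, smul_assoc] at h1
        have hpar : Even ((s : ℤ) * n) ↔ Even n := by
          rcases Int.units_eq_one_or s with rfl | rfl <;> simp
        simp only [hpar]
        by_cases he : Even n
        · rw [if_pos he] at h1 ⊢
          have h2 := congrArg (fun v => (-(2 * n : ℂ)) • v) h1
          simp only [smul_smul] at h2
          rw [show -(2 * n : ℂ) * -(1 / (2 * n)) = 1 by field_simp, one_smul,
            show -(2 * n : ℂ) * (-powerSum M (s * n) / n) = 2 * powerSum M (s * n) by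
              field_simp] at h2
          exact h2
        · rw [if_neg he] at h1 ⊢
          have h2 := congrArg (fun v => (n : ℂ) • v) h1
          simp only [smul_smul] at h2
          rw [show (n : ℂ) * (1 / n) = 1 by field_simp, one_smul,
            show (n : ℂ) * (-powerSum M (s * n) / n) = -1 * powerSum M (s * n) by
              field_simp] at h2
          exact h2
    have helt : ∀ k, σ.elt hζ k 1 (b.h i) =
        (if (σ.order : ℤ) ∣ k then (2 : ℂ)⁻¹ else 1) • σ.hLoop hζ i k := by
      intro k
      rw [σ.elt_h_of_middle hζ hi hm, smul_smul]
      split_ifs <;> simp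
    refine ⟨fun k => ⟨_, by rw [helt, act_smul, key, smul_smul]⟩, 1, fun k => ?_⟩
    have he : Even ((σ.order : ℤ) * k) := ((Int.even_coe_nat _).2 hev).mul_right k
    rw [helt, act_smul, key, smul_smul, if_pos (dvd_mul_right _ _), if_pos he, if_neg hi, hmap]
    congr 1
    ring
  · have key : ∀ k : ℤ, σ.act hζ (σ.hLoop hζ i k) w = powerSum M k • w := by
      intro k
      rcases eq_or_ne k 0 with rfl | hk
      · rw [h0, if_neg hm, hp0]
      · obtain ⟨s, n, hn, rfl⟩ := hsgn k hk
        have hn' : (n : ℂ) ≠ 0 := by exact_mod_cast hn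
        have h1 := hlog s n hn
        rw [logP, PowerSeries.coeff_mk, if_neg hn, if_neg hi, if_neg hm, smul_assoc] at h1
        have h2 := congrArg (fun v => (-(n : ℂ)) • v) h1
        simp only [smul_smul] at h2
        rw [show -(n : ℂ) * -(1 / n) = 1 by field_simp, one_smul,
          show -(n : ℂ) * (-powerSum M (s * n) / n) = powerSum M (s * n) by field_simp] at h2
        exact h2
    refine ⟨fun k => ⟨_, by rw [← σ.elt_h_of_ne hζ hi hm, key]⟩, 1, fun k => ?_⟩
    rw [← σ.elt_h_of_ne hζ hi hm, key, if_neg hi, hmap, one_mul]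

end Module

end DiagramAut

/-! ### The polynomial Q and the generator of the Weyl module. -/

namespace DiagramAut

variable {b : LieAlgebra.Basis I H} (σ : DiagramAut b) {ζ : ℂ} (hζ : IsPrimitiveRoot ζ σ.order)

lemma elt_e_mem_nPlus (k : ℤ) (r : Polynomial ℂ) (i : I) :
    (σ.elt hζ k r (b.e i) : LieAlgebra.loopAlgebra ℂ ℤ g) ∈
      Submodule.baseChange ℂ[T;T⁻¹] (nPlus b).toSubmodule := by
  rw [coe_elt]
  refine Submodule.tmul_mem_baseChange_of_mem _ (sum_mem fun l _ => ?_)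
  rw [σ.iterate_apply_of_perm b.e σ.map_e]
  exact Submodule.smul_mem _ _ (LieSubalgebra.subset_lieSpan ⟨_, rfl⟩)

variable [DecidableEq I]

/-- The inverse roots of a polynomial in the `i`-th place of an element of `𝒫_σ^+`, as roots of
polynomials in `t^m`. -/
def rootsPow (i : I) (M : Multiset ℂˣ) : Multiset ℂˣ :=
  if σ.perm i = i then M else M.map (· ^ σ.order)

lemma exists_eq_pow_of_mem_rootsPow {I₀ : Finset I} {l : ℕ} (lam : Fin l → I₀ → ℕ)
    (a : Fin l → ℂˣ) (i : I₀) {M : Multiset ℂˣ}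
    (hM : (∏ r, σ.piWeight I₀ (lam r) (a r)) i = ofInvRoots M) {c : ℂˣ}
    (hc : c ∈ σ.rootsPow i M) : ∃ r, c = a r ^ σ.order := by
  unfold rootsPow at hc
  split_ifs at hc with hi
  · obtain ⟨r, hr⟩ := σ.exists_eq_invRoot lam a i hM hc
    exact ⟨r, by rw [hr, invRoot, if_pos hi]⟩
  · obtain ⟨d, hd, rfl⟩ := Multiset.mem_map.1 hc
    obtain ⟨r, hr⟩ := σ.exists_eq_invRoot lam a i hM hd
    exact ⟨r, by rw [hr, invRoot, if_neg hi]⟩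

/-- The polynomial with simple roots at all the inverse roots, raised to the `m`-th power where
necessary. -/
def rootPoly {I₀ : Finset I} (M : I₀ → Multiset ℂˣ) : Polynomial ℂ :=
  ∏ c ∈ Finset.univ.biUnion fun i : I₀ => (σ.rootsPow i (M i)).toFinset,
    (Polynomial.X - Polynomial.C (c : ℂ))

lemma eval_rootPoly {I₀ : Finset I} (M : I₀ → Multiset ℂˣ) (i : I₀) {c : ℂˣ}
    (hc : c ∈ σ.rootsPow i (M i)) : (σ.rootPoly M).eval (c : ℂ) = 0 := by
  rw [rootPoly, Polynomial.eval_prod]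
  refine Finset.prod_eq_zero (i := c) ?_ (by simp)
  rw [Finset.mem_biUnion]
  exact ⟨i, Finset.mem_univ _, Multiset.mem_toFinset.2 hc⟩

/-- Each root of Q is some a_r^m, and distinct linear factors are coprime. Counting every root once
makes the divisibility valid for all factorizations. -/
lemma rootPoly_dvd {I₀ : Finset I} (M : I₀ → Multiset ℂˣ) {l : ℕ} (lam : Fin l → I₀ → ℕ)
    (a : Fin l → ℂˣ) (hM : ∀ i, (∏ r, σ.piWeight I₀ (lam r) (a r)) i = ofInvRoots (M i)) :
    σ.rootPoly M ∣ ∏ r, (Polynomial.X - Polynomial.C ((a r : ℂ) ^ σ.order)) := by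
  refine Finset.prod_dvd_of_coprime (fun c _ d _ hcd => ?_) (fun c hc => ?_)
  · exact Polynomial.isCoprime_X_sub_C_of_isUnit_sub
      (sub_ne_zero.2 fun h => hcd (Units.ext h)).isUnit
  · rw [Finset.mem_biUnion] at hc
    obtain ⟨i, _, hi⟩ := hc
    obtain ⟨r, rfl⟩ :=
      σ.exists_eq_pow_of_mem_rootsPow lam a i (hM i) (Multiset.mem_toFinset.1 hi)
    rw [Units.val_pow_eq_pow_val]
    exact Finset.dvd_prod_of_mem (fun r => Polynomial.X - Polynomial.C ((a r : ℂ) ^ σ.order))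
      (Finset.mem_univ r)

section WeylModule

variable {I₀ : Finset I} (p : I₀ → Polynomial ℂ)

/-- The generator of the Weyl module. -/
def weylGen : σ.WeylModule hζ p := Submodule.Quotient.mk 1

lemma exists_smul_weylGen (v : σ.WeylModule hζ p) : ∃ u : σ.Env hζ, u • σ.weylGen hζ p = v := by
  obtain ⟨u, rfl⟩ := Submodule.Quotient.mk_surjective _ v
  exact ⟨u, by rw [weylGen, ← Submodule.Quotient.mk_smul, smul_eq_mul, mul_one]⟩

lemma Rel.smul_weylGen {p : I₀ → Polynomial ℂ} {u : σ.Env hζ} (hu : σ.Rel hζ p u) :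
    u • σ.weylGen hζ p = 0 := by
  rw [weylGen, ← Submodule.Quotient.mk_smul, smul_eq_mul, mul_one, Submodule.Quotient.mk_eq_zero]
  exact Submodule.subset_span hu

variable [FiniteDimensional ℂ g] [LieAlgebra.IsSimple ℂ g]

lemma exists_act_weylGen_eq_zero (hb : b.A.IsSimplyLaced) (hI₀ : σ.IsOrbitReps I₀)
    (M : I₀ → Multiset ℂˣ) (hM : ∀ i, p i = ofInvRoots (M i)) :
    ∃ N : ℕ, ∀ x k, σ.act hζ (σ.elt hζ k (σ.rootPoly M ^ N) x) (σ.weylGen hζ p) = 0 := by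
  have he : ∀ i k r, σ.act hζ (σ.elt hζ k r (b.e i)) (σ.weylGen hζ p) = 0 := fun i k r =>
    Rel.smul_weylGen σ hζ (.nPlus _ (σ.elt_e_mem_nPlus hζ k r i))
  have halg : ∀ (u : σ.Env hζ) (c : ℂ), σ.Rel hζ p (u - algebraMap ℂ _ c) →
      u • σ.weylGen hζ p = c • σ.weylGen hζ p := fun u c h => by
    have := Rel.smul_weylGen σ hζ h
    rwa [sub_smul, sub_eq_zero, algebraMap_smul] at this
  have hf : ∀ i : I₀, b.f i ∈ σ.annSub hζ (σ.rootPoly M) (σ.weylGen hζ p) := by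
    intro i
    have h0 : σ.act hζ (σ.hLoop hζ i 0) (σ.weylGen hζ p) =
        (if σ.IsMiddle i then 2 * ((M i).card : ℂ) else (M i).card) • σ.weylGen hζ p := by
      have := halg _ _ (.weight i)
      rw [wt, hM, natDegree_ofInvRoots] at this
      convert this using 2
      split_ifs <;> push_cast <;> rfl
    have h1 : ∀ s n, PowerSeries.coeff n (σ.P hζ s i) • σ.weylGen hζ p =
        (signPoly s (ofInvRoots (M i))).coeff n • σ.weylGen hζ p := fun s n => by
      rw [← hM]
      exact halg _ _ (.series s i n)
    obtain ⟨h2, c, h3⟩ := σ.act_elt_h hζ hb i (M i) _ h0 h1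
    refine σ.f_mem_annSub hζ hb i _ _ (he i) h2 (fun r => ?_) (σ.wt p i) ?_
    · refine σ.act_elt_eq_zero_of_forall_eval hζ _ (σ.rootsPow i (M i)) _ c h3 _ fun a ha => ?_
      rw [Polynomial.eval_mul, σ.eval_rootPoly M i ha, zero_mul]
    · obtain ⟨d, _, hd⟩ := σ.xLoop_eq hζ i
      rw [hd, map_smul, smul_pow, smul_assoc, Rel.smul_weylGen σ hζ (.integrable i), smul_zero]
  -- Exponent 0 suffices for the e_i, since L^σ(n^+) kills the generator; an f_j outside the
  -- representatives is some σ^l(f_i) with i ∈ I₀.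
  refine σ.exists_forall_act_elt_eq_zero hζ _ _
    (fun i => ⟨0, fun k => he i k _⟩) fun j => ?_
  obtain ⟨i, ⟨hi, hij⟩, _⟩ := hI₀ j
  obtain ⟨l, rfl⟩ := hij.exists_nat_pow_eq
  rw [← σ.iterate_apply_of_perm b.f σ.map_f]
  exact σ.iterate_mem_annSub hζ _ _ (hf ⟨i, hi⟩) l

end WeylModule

end DiagramAut

end

end TwistedLoop

theorem mainTheorem4 {g I : Type*} [LieRing g] [LieAlgebra ℂ g] [FiniteDimensional ℂ g]
    [LieAlgebra.IsSimple ℂ g] [Fintype I] [DecidableEq I] {H : LieSubalgebra ℂ g}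
    (b : LieAlgebra.Basis I H) (hb : b.A.IsSimplyLaced)
    (σ : TwistedLoop.DiagramAut b) (hσ : σ.perm ≠ 1)
    (ζ : ℂ) (hζ : IsPrimitiveRoot ζ σ.order)
    (I₀ : Finset I) (hI₀ : σ.IsOrbitReps I₀)
    (p : I₀ → Polynomial ℂ) (hp : p ∈ σ.monoidP I₀) :
    ∃ N : ℕ, ∀ (l : ℕ) (lam : Fin l → I₀ → ℕ) (a : Fin l → ℂˣ),
      (∀ r, lam r ∈ σ.weights I₀) → p = ∏ r, σ.piWeight I₀ (lam r) (a r) →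
      ∀ (y : LieAlgebra.loopAlgebra ℂ ℤ g) (hy : y ∈ σ.annSpace ζ a N)
        (v : σ.WeylModule hζ p),
        UniversalEnvelopingAlgebra.ι ℂ (⟨y, σ.annSpace_le hζ a N hy⟩ : σ.twistedLoop hζ) • v
          = 0 := by
  -- The inverse roots, and with them N, are fixed before any factorization is introduced.
  choose M hM using σ.exists_eq_ofInvRoots hp
  obtain ⟨N, hN⟩ := σ.exists_act_weylGen_eq_zero hζ p hb hI₀ M hM
  refine ⟨N, fun l lam a _ hpa y hy v => ?_⟩
  have hdvd : σ.rootPoly M ^ N ∣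
      ∏ r, (Polynomial.X - Polynomial.C ((a r : ℂ) ^ σ.order)) ^ N := by
    rw [Finset.prod_pow]
    exact pow_dvd_pow_of_dvd (σ.rootPoly_dvd M lam a fun i => by rw [← hpa, hM]) N
  obtain ⟨z, hz⟩ := σ.annSpace_le_range hζ a N _ hdvd hy
  obtain ⟨u, rfl⟩ := σ.exists_smul_weylGen hζ p v
  rw [show (⟨y, σ.annSpace_le hζ a N hy⟩ : σ.twistedLoop hζ) =
    σ.tr hζ (σ.polyT (σ.rootPoly M ^ N) • z) from Subtype.ext hz]
  exact σ.act_tr_smul_eq_zero hζ _ _ hN u z
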